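/- Let $u=(u_1,\dots,u_n)$ be a nonzero real vector with $0\le u_1\le\dots\le u_n$. A vector $a\in\mathbb R_{\ge 0}^n$ is a $u$-parking function if its nondecreasing rearrangement $b_1\le\dots\le b_n$ satisfies $b_i\le u_i$ for all $i$; $\mathrm{PF}(u)$ is the convex hull of all $u$-parking functions. Let $d=(d_1<\dots<d_\ell)$ be the distinct positive entries of $u$ and $m=(m_0,m_1,\dots,m_\ell)$, where $m_0$ is the number of zeros of $u$ and $m_i$ the number of entries equal to $d_i$; $(m,d)$ is called the MD pair of $u$, it determines $u$, and we write $\mathrm{PF}(m,d)=\mathrm{PF}(u)$. For a polytope $P\subset\mathbb R^n$, a nonempty face is a set of the form $\{x\in P: h\cdot x\ge h\cdot y\ \forall y\in P\}$ with $h\in\mathbb R^n$; the face poset is the set of nonempty faces ordered by inclusion. The normal cone at a face $F$ is $\{w: w\cdot x\ge w\cdot y\ \forall x\in F,\ y\in P\}$, and the normal fan $\Sigma(P)$ is the set of the normal cones at all nonempty faces, ordered by inclusion. A skewed binary partition of $[0,n]=\{0,\dots,n\}$ is a tuple $\mathcal B=(B_{-1},B_0,B_1,\dots,B_k)$, $k\ge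 0$, of disjoint sets with union $[0,n]$, some of which are marked homogeneous, such that: only blocks with at least two elements may be homogeneous; $B_{-1}$ is not homogeneous; $B_0$ is homogeneous if $|B_0|\ge2$; $0\in B_{-1}\cup B_0$; if $0\in B_{-1}$, then $|B_{-1}|\ge 2$ and $B_0=\emptyset$; and $B_i\ne\emptyset$ for $i\ge1$. Its preorder $\preceq_{\mathcal B}$ on $[0,n]$ is: $p\preceq_{\mathcal B}q$ iff $p=q$, or $p\in B_i$, $q\in B_j$ with $i<j$, or $p,q$ lie in a common homogeneous block. Its type is $(b_{-1},b_0,\dots,b_k)$, where for $i\ge1$, $b_i=|B_i|$ if $B_i$ is not homogeneous and $b_i=|B_i|^\star$ if it is; $(b_{-1},b_0)=(|B_{-1}|,(|B_0|-1)^\circ)$ if $0\in B_0$; and $(b_{-1},b_0)=(|B_{-1}|-1,0)$ if $0\in B_{-1}$ (the superscripts $\star,\circ$ are formal marks). The sliced preorder cone is $$\tilde\sigma_{\mathcal B}=\{(c_1,\dots,c_n)\in\mathbb R^n: c_i\le c_j\text{ whenever } i\preceq_{\mathcal B}j,\ i,j\in[0,n]\},\qquad c_0:=0.$$ Contracting an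 edge of the Hasse diagram of a preorder, that is, a pair $a,b$ such that the class of $b$ covers the class of $a$, means passing to the smallest preorder that contains the given one and in which also $b\preceq a$. We say that $\mathcal C$ is a contraction of $\mathcal B$ if $\preceq_{\mathcal C}$ is obtained from $\preceq_{\mathcal B}$ by a finite (possibly empty) sequence of edge contractions. Put $r=m_1+\dots+m_\ell$ and $\Omega_m=\{\mathbf a_0,\dots,\mathbf a_r\}$, where $\mathbf a_0=(m_0,0,m_1,\dots,m_\ell)$ if $m_0>0$ and $\mathbf a_0=(0,0^\circ,m_1,\dots,m_\ell)$ if $m_0=0$; for $1\le i<r$, $\mathbf a_i=(m_0+i,0^\circ,m_1+\dots+m_g-i,m_{g+1},\dots,m_\ell)$ with $g\ge 1$ determined by $m_1+\dots+m_{g-1}\le i<m_1+\dots+m_g$; and $\mathbf a_r=(n,0^\circ)$. Let $\mathcal{SBP}(m)$ be the set of skewed binary partitions of $[0,n]$ that are contractions of some skewed binary partition with type in $\Omega_m$, ordered by $\mathcal B\le\mathcal B'$ iff $\mathcal B$ is a contraction of $\mathcal B'$. Then, for every MD pair $(m,d)$: (1) the map $\mathcal B\mapsto\tilde\sigma_{\mathcal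 B}$ is a poset isomorphism from $\mathcal{SBP}(m)$ onto $\Sigma(\mathrm{PF}(m,d))$; (2) the face poset of $\mathrm{PF}(m,d)$ is isomorphic to the dual of $\mathcal{SBP}(m)$; (3) the combinatorial type depends only on $m$: if $(m,d)$ and $(m,d')$ are MD pairs, then $\mathrm{PF}(m,d)$ and $\mathrm{PF}(m,d')$ have isomorphic face posets. -/

import Mathlib

namespace ParkingPolytope

open Matrix

/-! ### Faces, normal cones and normal fans -/

/-- `F` is the face of `P` on which some linear functional attains its maximum over `P`. -/
def IsFace {n : ℕ} (P F : Set (Fin n → ℝ)) : Prop :=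
  ∃ h : Fin n → ℝ, F = {x | x ∈ P ∧ ∀ y ∈ P, h ⬝ᵥ y ≤ h ⬝ᵥ x}

/-- The set of nonempty faces of `P`; as a subtype it is ordered by inclusion. -/
def faces {n : ℕ} (P : Set (Fin n → ℝ)) : Set (Set (Fin n → ℝ)) :=
  {F | F.Nonempty ∧ IsFace P F}

/-- The normal cone of `P` at `F`. -/
def normalCone {n : ℕ} (F P : Set (Fin n → ℝ)) : Set (Fin n → ℝ) :=
  {w | ∀ x ∈ F, ∀ y ∈ P, w ⬝ᵥ y ≤ w ⬝ᵥ x}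

/-- The set of normal cones of `P` at its nonempty faces; as a subtype it is ordered by
inclusion. -/
def normalFan {n : ℕ} (P : Set (Fin n → ℝ)) : Set (Set (Fin n → ℝ)) :=
  {σ | ∃ F ∈ faces P, σ = normalCone F P}

/-! ### Parking function polytopes -/

/-- `a` is a `u`-parking function: it is nonnegative and its nondecreasing rearrangement
`a ∘ Tuple.sort a` is bounded by `u` in every coordinate. -/
def IsParkingFunction {n : ℕ} (u a : Fin n → ℝ) : Prop :=
  (∀ i, 0 ≤ a i) ∧ ∀ i, a (Tuple.sort a i) ≤ u i

/-- The parking function polytope `PF(u)`. -/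
def PF {n : ℕ} (u : Fin n → ℝ) : Set (Fin n → ℝ) :=
  convexHull ℝ {a | IsParkingFunction u a}

/-- The data vector `(d_1, …, d_ℓ)` of `u`: its distinct positive entries in increasing order. -/
noncomputable def dataVector {n : ℕ} (u : Fin n → ℝ) : List ℝ :=
  ((Finset.univ.image u).filter (fun x => 0 < x)).sort (· ≤ ·)

/-- The multiplicity vector `(m_0, m_1, …, m_ℓ)` of `u`: the number of zeros of `u`, followed by
the number of occurrences of each entry of the data vector. -/
noncomputable def multiplicityVector {n : ℕ} (u : Fin n → ℝ) : List ℕ :=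
  (0 :: dataVector u).map fun x => (Finset.univ.filter fun i => u i = x).card

/-- `u` is a nonzero nondecreasing vector of nonnegative reals and `(m, d)` is its MD pair.
The pair `(m, d)` determines `u`, and `PF(m, d)` means `PF(u)`. -/
structure IsMDPairOf {n : ℕ} (m : List ℕ) (d : List ℝ) (u : Fin n → ℝ) : Prop where
  nonneg : ∀ i, 0 ≤ u i
  monotone : Monotone u
  ne_zero : u ≠ 0
  multiplicity : multiplicityVector u = m
  data : dataVector u = d

/-! ### Contractions of preorders and sliced preorder cones -/

/-- `b` covers `a` in the preorder `r`: the class of `b` covers the class of `a` in the poset of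
equivalence classes of `r`. -/
def Covers {α : Type*} (r : α → α → Prop) (a b : α) : Prop :=
  r a b ∧ ¬ r b a ∧ ∀ c, r a c → r c b → r c a ∨ r b c

/-- The preorder `s` arises from the preorder `r` by contracting one edge of the Hasse diagram:
for some `b` covering `a`, the classes of `a` and `b` are merged, so that `s` is the smallest
preorder containing `r` in which also `b` lies below `a`. -/
def ContractsEdge {α : Type*} (r s : α → α → Prop) : Prop :=
  ∃ a b, Covers r a b ∧
    s = Relation.ReflTransGen (fun x y => r x y ∨ (x = b ∧ y = a))

/-- The preorder `s` is a contraction of the preorder `r`: it arises by a finite (possibly empty)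
sequence of edge contractions. -/
def IsContraction {α : Type*} (s r : α → α → Prop) : Prop :=
  Relation.ReflTransGen ContractsEdge r s

/-- The sliced preorder cone of a preorder `r` on `[0, n]`. The coordinates `c_1, …, c_n` are
indexed by `Fin n`, and `Fin.cons 0 c` is `(0, c_1, …, c_n)`. -/
def slicedCone {n : ℕ} (r : Fin (n + 1) → Fin (n + 1) → Prop) : Set (Fin n → ℝ) :=
  {c | ∀ i j, r i j →
    (Fin.cons 0 c : Fin (n + 1) → ℝ) i ≤ (Fin.cons 0 c : Fin (n + 1) → ℝ) j}

/-! ### Skewed binary partitions -/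

/-- A skewed binary partition `(B_{-1}, B_0, B_1, …, B_k)` of `[0, n]`. The block `B_i` is
`block (i + 1)`, and `homog` marks the homogeneous blocks. Blocks with at most one element carry
no mark. -/
structure SkewedBinaryPartition (n : ℕ) where
  k : ℕ
  block : Fin (k + 2) → Finset (Fin (n + 1))
  homog : Fin (k + 2) → Bool
  disjoint : ∀ i j, i ≠ j → Disjoint (block i) (block j)
  cover : ∀ p, ∃ i, p ∈ block i
  homog_first : homog 0 = false
  homog_second : 2 ≤ (block 1).card → homog 1 = true
  zero_mem : 0 ∈ block 0 ∨ 0 ∈ block 1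
  of_zero_mem_first : 0 ∈ block 0 → 2 ≤ (block 0).card ∧ block 1 = ∅
  two_le_of_homog : ∀ i, homog i = true → 2 ≤ (block i).card
  nonempty : ∀ i : Fin k, (block i.succ.succ).Nonempty

/-- Entries of skewed binary compositions: `i`, `i^∘` and `i^⋆`. -/
inductive Entry where
  | plain (i : ℕ)
  | circ (i : ℕ)
  | star (i : ℕ)

namespace SkewedBinaryPartition

variable {n : ℕ}

/-- The preorder of a skewed binary partition: elements of an earlier block lie below those of a
later one, elements of one homogeneous block are equivalent, and distinct elements of one
non-homogeneous block are incomparable. Empty blocks have no influence. -/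
def rel (B : SkewedBinaryPartition n) (p q : Fin (n + 1)) : Prop :=
  p = q ∨ ∃ i j, p ∈ B.block i ∧ q ∈ B.block j ∧ (i < j ∨ (i = j ∧ B.homog i = true))

/-- The type `(b_{-1}, b_0, b_1, …, b_k)` of a skewed binary partition. -/
def type (B : SkewedBinaryPartition n) : List Entry :=
  (if 0 ∈ B.block 1 then
      [Entry.plain (B.block 0).card, Entry.circ ((B.block 1).card - 1)]
    else
      [Entry.plain ((B.block 0).card - 1), Entry.plain 0]) ++
  List.ofFn fun i : Fin B.k =>
    if B.homog i.succ.succ = true then Entry.star (B.block i.succ.succ).card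
    else Entry.plain (B.block i.succ.succ).card

end SkewedBinaryPartition

/-- The first element `a_0` of `Ω_m`, for `m = (m₀, ms)`. -/
def omegaZero (m₀ : ℕ) (ms : List ℕ) : List Entry :=
  (if 0 < m₀ then [Entry.plain m₀, Entry.plain 0] else [Entry.plain 0, Entry.circ 0]) ++
    ms.map Entry.plain

/-- The set `Ω_m = {a_0, …, a_r}` of skewed binary compositions, `r = m_1 + ⋯ + m_ℓ`. The three
parts of the union for `m = (m₀, ms)` are `a_0`, the `a_i` with `1 ≤ i < r`, and `a_r`. -/
def Omega : List ℕ → Set (List Entry)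
  | [] => ∅
  | m₀ :: ms =>
    {omegaZero m₀ ms} ∪
    {b | ∃ i g : ℕ, 1 ≤ i ∧ 1 ≤ g ∧ (ms.take (g - 1)).sum ≤ i ∧ i < (ms.take g).sum ∧
      b = [Entry.plain (m₀ + i), Entry.circ 0, Entry.plain ((ms.take g).sum - i)] ++
        (ms.drop g).map Entry.plain} ∪
    {[Entry.plain (m₀ + ms.sum), Entry.circ 0]}

/-- `SBP(m)`: the skewed binary partitions of `[0, n]` that are contractions of a skewed binary
partition with type in `Ω_m`. -/
def SBP (n : ℕ) (m : List ℕ) : Type :=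
  {B : SkewedBinaryPartition n //
    ∃ A : SkewedBinaryPartition n, A.type ∈ Omega m ∧ IsContraction B.rel A.rel}

/-- `SBP(m)` is ordered by contraction. Antisymmetry holds as well; it is implied by an order
isomorphism with a family of sets ordered by inclusion. -/
instance (n : ℕ) (m : List ℕ) : Preorder (SBP n m) where
  le B B' := IsContraction B.1.rel B'.1.rel
  le_refl _ := Relation.ReflTransGen.refl
  le_trans _ _ _ h h' := Relation.ReflTransGen.trans h' h

end ParkingPolytope

/-!
A family of points of `P`, each with a cone of functionals maximised there, that together cover
`ℝⁿ` determines the normal fan of `P`: when the cones come from preorders on `[0, n]` and every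
strict relation is realised by a direction from the point into `P`, the normal cones at faces
through the point are the cones of the contractions of its preorder, and inclusion of cones is
contraction of preorders. For `PF(u)` the points are the vectors obtained from `u` by replacing
the first `K` entries by `0` and permuting, and the preorder at such a vertex compares the
coordinates by the entries of the vertex, with `0` above the truncated coordinates and below the
others. By counting entries, these preorders are those of the skewed binary partitions with type
in `Ω_m`, and contractions of such preorders again come from skewed binary partitions. Faces are
dual to normal cones.
-/

namespace ParkingPolytope

open Matrix

/-! ### Contracting the ties of a preorder -/

section Contractions

variable {α β : Type*} {r r' s : α → α → Prop}

/-- `w` is monotone from the preorder `r` to `β`. Preorders are relations here rather than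
instances, since several of them live on one type. -/
def MonotoneAlong [LE β] (r : α → α → Prop) (w : α → β) : Prop :=
  ∀ x y, r x y → w x ≤ w y

/-- `w` is monotone along `r`, and strictly so across the classes of `r`. -/
def StrictMonotoneAlong [LE β] (r : α → α → Prop) (w : α → β) : Prop :=
  MonotoneAlong r w ∧ ∀ x y, r x y → w x = w y → r y x

/-- The smallest preorder that contains `r` and in which two elements related by `r` are
equivalent as soon as `w` takes the same value on them. -/
def tieContraction (r : α → α → Prop) (w : α → β) : α → α → Prop :=
  Relation.ReflTransGen fun x y => r x y ∨ (r y x ∧ w x = w y)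

instance (r : α → α → Prop) (w : α → β) : IsPreorder α (tieContraction r w) :=
  inferInstanceAs (IsPreorder α (Relation.ReflTransGen _))

lemma le_tieContraction (r : α → α → Prop) (w : α → β) : r ≤ tieContraction r w :=
  fun _ _ h => .single (.inl h)

lemma tieContraction_le [IsPreorder α s] {w : α → β} (hrs : r ≤ s)
    (hw : ∀ x y, r x y → w x = w y → s y x) : tieContraction r w ≤ s := by
  intro x y h
  induction h with
  | refl => exact refl x
  | tail _ hstep ih =>
    exact _root_.trans ih (hstep.elim (hrs _ _) fun ⟨h, hxy⟩ => hw _ _ h hxy.symm)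

lemma StrictMonotoneAlong.tieContraction_le [LE β] [IsPreorder α s] {w : α → β}
    (hw : StrictMonotoneAlong s w) (hrs : r ≤ s) : tieContraction r w ≤ s :=
  ParkingPolytope.tieContraction_le hrs fun x y h => hw.2 x y (hrs x y h)

lemma StrictMonotoneAlong.tieContraction_eq [LE β] [IsPreorder α r] {w : α → β}
    (hw : StrictMonotoneAlong r w) : tieContraction r w = r :=
  (hw.tieContraction_le le_rfl).antisymm (le_tieContraction r w)

lemma monotoneAlong_tieContraction_iff {γ : Type*} [Preorder γ] {w : α → β} {w' : α → γ} :
    MonotoneAlong (tieContraction r w) w' ↔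
      MonotoneAlong r w' ∧ ∀ x y, r x y → w x = w y → w' y ≤ w' x := by
  refine ⟨fun h => ⟨fun x y hxy => h x y (.single (.inl hxy)), fun x y hxy hw =>
    h y x (.single (.inr ⟨hxy, hw.symm⟩))⟩, fun ⟨hmono, htie⟩ x y hxy => ?_⟩
  induction hxy with
  | refl => exact le_rfl
  | tail _ hstep ih =>
    exact ih.trans (hstep.elim (hmono _ _) fun h => htie _ _ h.1 h.2.symm)

lemma MonotoneAlong.strictMonotoneAlong_tieContraction [PartialOrder β] {w : α → β}
    (hw : MonotoneAlong r w) : StrictMonotoneAlong (tieContraction r w) w := by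
  have hmono : MonotoneAlong (tieContraction r w) w :=
    monotoneAlong_tieContraction_iff.2 ⟨hw, fun _ _ _ => ge_of_eq⟩
  refine ⟨hmono, fun x y h => ?_⟩
  induction h with
  | refl => exact fun _ => .refl
  | @tail y z hxy hyz ih =>
    intro hxz
    have hyx : w x = w y :=
      (hmono x y hxy).antisymm (hxz ▸ hmono y z (.single hyz))
    have hzy : w z = w y := hxz.symm.trans hyx
    exact .head (hyz.elim (fun h => .inr ⟨h, hzy⟩) fun h => .inl h.1) (ih hyx)

lemma tieContraction_eq_of_le [PartialOrder β] {w : α → β} (hw : MonotoneAlong r w)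
    (hr' : r ≤ r') (h : r' ≤ tieContraction r w) : tieContraction r' w = tieContraction r w :=
  (hw.strictMonotoneAlong_tieContraction.tieContraction_le h).antisymm <|
    tieContraction_le (hr'.trans (le_tieContraction r' w)) fun x y hxy hxy' =>
      .single (.inr ⟨hr' x y hxy, hxy'.symm⟩)

lemma ContractsEdge.isPreorder (h : ContractsEdge r s) : IsPreorder α s := by
  obtain ⟨a, b, -, rfl⟩ := h
  infer_instance

lemma ContractsEdge.le (h : ContractsEdge r s) : r ≤ s := by
  obtain ⟨a, b, -, rfl⟩ := h
  exact fun _ _ h => .single (.inl h)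

lemma IsContraction.isPreorder [IsPreorder α r] (h : IsContraction s r) : IsPreorder α s := by
  induction h with
  | refl => infer_instance
  | tail _ h _ => exact h.isPreorder

lemma IsContraction.le (h : IsContraction s r) : r ≤ s := by
  induction h with
  | refl => exact le_rfl
  | tail _ h ih => exact ih.trans h.le

lemma IsContraction.le_tieContraction [PartialOrder β] {w : α → β} (h : IsContraction s r)
    (hw : MonotoneAlong s w) : s ≤ tieContraction r w := by
  induction h with
  | refl => exact ParkingPolytope.le_tieContraction r w
  | @tail t s hrt hts ih =>
    have hwt : MonotoneAlong t w := fun x y hxy => hw x y (hts.le x y hxy)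
    have hstrict := MonotoneAlong.strictMonotoneAlong_tieContraction fun x y hxy =>
      hwt x y (IsContraction.le hrt x y hxy)
    obtain ⟨a, b, hab, rfl⟩ := hts
    have htab := ih hwt a b hab.1
    have hba : w a = w b := (hstrict.1 a b htab).antisymm (hw b a (.single (.inr ⟨rfl, rfl⟩)))
    intro x y hxy
    induction hxy with
    | refl => exact refl x
    | tail _ hyz ihxy =>
      refine _root_.trans ihxy (hyz.elim (ih hwt _ _) ?_)
      rintro ⟨rfl, rfl⟩
      exact hstrict.2 _ _ htab hba

lemma IsContraction.eq_tieContraction [PartialOrder β] [IsPreorder α r] {w : α → β}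
    (h : IsContraction s r) (hw : StrictMonotoneAlong s w) : s = tieContraction r w :=
  have := h.isPreorder
  (h.le_tieContraction hw.1).antisymm (hw.tieContraction_le h.le)

lemma exists_strictMonotoneAlong [Finite α] (r : α → α → Prop) [IsPreorder α r] :
    ∃ w : α → ℝ, StrictMonotoneAlong r w := by
  have hsub : ∀ x y, r x y → {z | r z x} ⊆ {z | r z y} := fun x y hxy z hz =>
    _root_.trans hz hxy
  refine ⟨fun x => ({z | r z x}.ncard : ℝ), fun x y hxy => ?_, fun x y hxy heq => ?_⟩
  · exact Nat.cast_le.2 (Set.ncard_le_ncard (hsub x y hxy))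
  · exact (Set.eq_of_subset_of_ncard_le (hsub x y hxy) (Nat.cast_injective heq).ge).ge (refl y)

lemma exists_covers [Finite α] [IsPreorder α r] {x y : α} (hxy : r x y) (hyx : ¬ r y x) :
    ∃ z, Covers r x z ∧ r z y := by
  obtain ⟨w, hw⟩ := exists_strictMonotoneAlong r
  obtain ⟨z, ⟨hxz, hzx, hzy⟩, hmin⟩ :=
    Set.exists_min_image {z | r x z ∧ ¬ r z x ∧ r z y} w (Set.toFinite _) ⟨y, hxy, hyx, refl y⟩
  refine ⟨z, ⟨hxz, hzx, fun c hxc hcz => or_iff_not_imp_left.2 fun hcx => ?_⟩, hzy⟩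
  exact hw.2 c z hcz ((hw.1 c z hcz).antisymm (hmin c ⟨hxc, hcx, _root_.trans hcz hzy⟩))

lemma isContraction_tieContraction [Finite α] [PartialOrder β] [hr : IsPreorder α r] {w : α → β}
    (hw : MonotoneAlong r w) : IsContraction (tieContraction r w) r := by
  induction r using WellFoundedGT.induction generalizing hr with
  | ind r ih =>
    by_cases hstrict : StrictMonotoneAlong r w
    · rw [hstrict.tieContraction_eq]
      exact .refl
    obtain ⟨x, y, hxy, hwxy, hyx⟩ : ∃ x y, r x y ∧ w x = w y ∧ ¬ r y x := by
      simpa [StrictMonotoneAlong, hw] using hstrict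
    obtain ⟨z, hxz, hzy⟩ := exists_covers hxy hyx
    have hwxz : w z = w x := ((hw z y hzy).trans hwxy.ge).antisymm (hw x z hxz.1)
    obtain ⟨t, ht⟩ : ∃ t, t = Relation.ReflTransGen fun a b => r a b ∨ (a = z ∧ b = x) := ⟨_, rfl⟩
    have hedge : ContractsEdge r t := ⟨x, z, hxz, ht⟩
    have htzx : t z x := ht ▸ .single (.inr ⟨rfl, rfl⟩)
    have hle : t ≤ tieContraction r w := ht ▸ Relation.ReflTransGen.mono (by
      rintro a b (hab | ⟨rfl, rfl⟩)
      · exact .inl hab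
      · exact .inr ⟨hxz.1, hwxz⟩)
    have := hedge.isPreorder
    have hwt : MonotoneAlong t w := fun a b hab =>
      hw.strictMonotoneAlong_tieContraction.1 a b (hle a b hab)
    rw [← tieContraction_eq_of_le hw hedge.le hle]
    exact .head hedge (ih t (lt_of_le_not_ge hedge.le fun h => hxz.2.1 (h z x htzx)) hwt)

end Contractions

/-! ### Sliced preorder cones -/

section SlicedCone

variable {n : ℕ} {r s : Fin (n + 1) → Fin (n + 1) → Prop}

/-- The vector `(0, c_1, …, c_n)` whose order relations define the sliced preorder cones. -/
def consZero (c : Fin n → ℝ) : Fin (n + 1) → ℝ := Fin.cons 0 c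

@[simp] lemma consZero_zero (c : Fin n → ℝ) : consZero c 0 = 0 := rfl

@[simp] lemma consZero_succ (c : Fin n → ℝ) (i : Fin n) : consZero c i.succ = c i := rfl

lemma consZero_sub_smul (w w' : Fin n → ℝ) (ε : ℝ) :
    consZero (w - ε • w') = consZero w - ε • consZero w' := by
  ext p
  cases p using Fin.cases <;> simp

lemma consZero_sub_const (f : Fin (n + 1) → ℝ) (p : Fin (n + 1)) :
    consZero (fun i => f i.succ - f 0) p = f p - f 0 := by
  cases p using Fin.cases <;> simp

lemma mem_slicedCone {c : Fin n → ℝ} : c ∈ slicedCone r ↔ MonotoneAlong r (consZero c) := Iff.rfl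

lemma slicedCone_anti (h : r ≤ s) : slicedCone s ⊆ slicedCone r :=
  fun _ hc i j hij => hc i j (h i j hij)

lemma sub_const_mem_slicedCone_iff {f : Fin (n + 1) → ℝ} :
    (fun i : Fin n => f i.succ - f 0) ∈ slicedCone r ↔ MonotoneAlong r f := by
  simp only [mem_slicedCone, MonotoneAlong, consZero_sub_const, sub_le_sub_iff_right]

lemma slicedCone_subset_iff [IsPreorder _ s] : slicedCone s ⊆ slicedCone r ↔ r ≤ s := by
  classical
  refine ⟨fun h p q hpq => ?_, slicedCone_anti⟩
  have hmono : MonotoneAlong s fun x => if s p x then (1 : ℝ) else 0 := by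
    intro x y hxy
    by_cases hx : s p x
    · simp [hx, _root_.trans hx hxy]
    · simp only [hx, if_false]
      positivity
  have hle := sub_const_mem_slicedCone_iff.1 (h (sub_const_mem_slicedCone_iff.2 hmono)) p q hpq
  by_contra hq
  norm_num [refl_of s p, hq] at hle

lemma slicedCone_inj [IsPreorder _ r] [IsPreorder _ s] : slicedCone r = slicedCone s ↔ r = s :=
  ⟨fun h => (slicedCone_subset_iff.1 h.ge).antisymm (slicedCone_subset_iff.1 h.le), congrArg _⟩

lemma exists_strictMonotoneAlong_consZero (r : Fin (n + 1) → Fin (n + 1) → Prop)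
    [IsPreorder _ r] : ∃ w : Fin n → ℝ, StrictMonotoneAlong r (consZero w) := by
  obtain ⟨f, hf⟩ := exists_strictMonotoneAlong r
  refine ⟨_, sub_const_mem_slicedCone_iff.2 hf.1, fun i j hij heq => hf.2 i j hij ?_⟩
  simpa only [consZero_sub_const, sub_left_inj] using heq

lemma MonotoneAlong.exists_sub_smul {α : Type*} [Finite α] {r : α → α → Prop} {w w' : α → ℝ}
    (hw : MonotoneAlong r w) (h : ∀ x y, r x y → w x = w y → w' y ≤ w' x) :
    ∃ ε : ℝ, 0 < ε ∧ MonotoneAlong r (w - ε • w') := by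
  have hev : ∀ x y, ∀ᶠ ε in nhdsWithin (0 : ℝ) (Set.Ioi 0), r x y →
      (w - ε • w') x ≤ (w - ε • w') y := by
    intro x y
    by_cases hxy : r x y
    swap
    · exact .of_forall fun _ h => absurd h hxy
    rcases (hw x y hxy).lt_or_eq with hlt | heq
    · have hcont : Continuous fun ε : ℝ => (w - ε • w') y - (w - ε • w') x := by
        simp only [Pi.sub_apply, Pi.smul_apply, smul_eq_mul]
        fun_prop
      have hpos : ∀ᶠ ε in nhds (0 : ℝ), 0 < (w - ε • w') y - (w - ε • w') x :=
        hcont.continuousAt.eventually (lt_mem_nhds (by simpa using hlt))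
      exact (hpos.filter_mono nhdsWithin_le_nhds).mono fun ε hε _ => (sub_pos.1 hε).le
    · filter_upwards [self_mem_nhdsWithin] with ε hε _
      simp only [Pi.sub_apply, Pi.smul_apply, smul_eq_mul, heq]
      exact sub_le_sub_left (mul_le_mul_of_nonneg_left (h x y hxy heq) (Set.mem_Ioi.1 hε).le) _
  obtain ⟨ε, hε, hpos⟩ :=
    ((Filter.eventually_all.2 fun x => Filter.eventually_all.2 (hev x)).and
      self_mem_nhdsWithin).exists
  exact ⟨ε, hpos, hε⟩

end SlicedCone

/-! ### Faces and normal cones -/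

section Faces

variable {n : ℕ} {P : Set (Fin n → ℝ)}

/-- The face of `P` in direction `w`, on which `w` is maximal. -/
def maxFace (P : Set (Fin n → ℝ)) (w : Fin n → ℝ) : Set (Fin n → ℝ) :=
  {x | x ∈ P ∧ ∀ y ∈ P, w ⬝ᵥ y ≤ w ⬝ᵥ x}

lemma normalCone_subset_iff {F F' : Set (Fin n → ℝ)} (hF : IsFace P F) (hF' : IsFace P F') :
    normalCone F' P ⊆ normalCone F P ↔ F ⊆ F' := by
  obtain ⟨h, rfl⟩ := hF
  obtain ⟨h', rfl⟩ := hF'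
  refine ⟨fun hsub x hx => ⟨hx.1, hsub (a := h') (fun y hy => hy.2) x hx⟩, ?_⟩
  exact fun hsub w hw x hx => hw x (hsub hx)

/-- The bijection between faces and normal cones, which reverses inclusions. -/
noncomputable def facesOrderIso (P : Set (Fin n → ℝ)) : faces P ≃o (normalFan P)ᵒᵈ :=
  RelIso.ofSurjective
    (OrderEmbedding.ofMapLEIff
      (fun F : faces P => OrderDual.toDual (⟨normalCone F.1 P, F.1, F.2, rfl⟩ : normalFan P))
      fun F F' => normalCone_subset_iff F.2.2 F'.2.2)
    fun ⟨_, F, hF, hσ⟩ => ⟨⟨F, hF⟩, Subtype.ext hσ.symm⟩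

/-- The vectors `e_0 = 0, e_1, …, e_n` on which a linear form `w` takes the values
`consZero w`. -/
def edgeVector (i : Fin (n + 1)) : Fin n → ℝ :=
  Fin.cons (α := fun _ => Fin n → ℝ) 0 (fun j => Pi.single j 1) i

@[simp] lemma edgeVector_zero : edgeVector (0 : Fin (n + 1)) = 0 := rfl

@[simp] lemma edgeVector_succ (i : Fin n) : edgeVector i.succ = Pi.single i (1 : ℝ) := rfl

@[simp] lemma dotProduct_edgeVector (w : Fin n → ℝ) (i : Fin (n + 1)) :
    w ⬝ᵥ edgeVector i = consZero w i := by
  cases i using Fin.cases <;> simp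

/-- The preorder `r` describes the polytope `P` near its vertex `v`: the linear forms in the
sliced cone of `r` are maximal at `v`, and each relation `i ≤ j` of `r` gives a direction
`e_i - e_j` in which `P` extends from `v`. -/
structure IsVertexPreorder (P : Set (Fin n → ℝ)) (v : Fin n → ℝ)
    (r : Fin (n + 1) → Fin (n + 1) → Prop) : Prop where
  isPreorder : IsPreorder _ r
  mem : v ∈ P
  dotProduct_le : ∀ w ∈ slicedCone r, ∀ y ∈ P, w ⬝ᵥ y ≤ w ⬝ᵥ v
  exists_add_mem : ∀ i j, r i j → ∃ t : ℝ, 0 < t ∧ v + t • (edgeVector i - edgeVector j) ∈ P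

namespace IsVertexPreorder

variable {v w : Fin n → ℝ} {r : Fin (n + 1) → Fin (n + 1) → Prop}

lemma mem_maxFace (h : IsVertexPreorder P v r) (hw : w ∈ slicedCone r) : v ∈ maxFace P w :=
  ⟨h.mem, h.dotProduct_le w hw⟩

theorem normalCone_maxFace (h : IsVertexPreorder P v r) (hw : w ∈ slicedCone r) :
    normalCone (maxFace P w) P = slicedCone (tieContraction r (consZero w)) := by
  have hv := h.mem_maxFace hw
  ext w'
  rw [mem_slicedCone, monotoneAlong_tieContraction_iff]
  constructor
  · intro hw'
    refine ⟨fun i j hij => ?_, fun i j hij heq => ?_⟩ <;>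
      obtain ⟨t, ht, hmem⟩ := h.exists_add_mem i j hij
    · have := hw' v hv _ hmem
      simp only [dotProduct_add, dotProduct_smul, dotProduct_sub, dotProduct_edgeVector,
        smul_eq_mul] at this
      nlinarith
    · have hface : v + t • (edgeVector i - edgeVector j) ∈ maxFace P w :=
        ⟨hmem, fun y hy => by simpa [dotProduct_sub, heq] using hv.2 y hy⟩
      have := hw' _ hface v h.mem
      simp only [dotProduct_add, dotProduct_smul, dotProduct_sub, dotProduct_edgeVector,
        smul_eq_mul] at this
      nlinarith
  · rintro ⟨hmono, htie⟩ x hx y hy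
    obtain ⟨ε, hε, hsub⟩ := (mem_slicedCone.1 hw).exists_sub_smul htie
    rw [← consZero_sub_smul] at hsub
    have hxv : (w - ε • w') ⬝ᵥ x ≤ (w - ε • w') ⬝ᵥ v := h.dotProduct_le _ hsub x hx.1
    have hwvx : w ⬝ᵥ v ≤ w ⬝ᵥ x := hx.2 v h.mem
    simp only [sub_dotProduct, smul_dotProduct, smul_eq_mul] at hxv
    exact (h.dotProduct_le w' hmono y hy).trans (by nlinarith)

end IsVertexPreorder

/-- A family of preorders that describe `P` near its vertices and whose sliced cones cover the
space, so that these cones are the maximal cones of the normal fan. -/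
structure IsVertexFamily (P : Set (Fin n → ℝ)) (R : Set (Fin (n + 1) → Fin (n + 1) → Prop)) :
    Prop where
  exists_vertex : ∀ r ∈ R, ∃ v, IsVertexPreorder P v r
  exists_mem_slicedCone : ∀ w, ∃ r ∈ R, w ∈ slicedCone r

namespace IsVertexFamily

variable {R : Set (Fin (n + 1) → Fin (n + 1) → Prop)} {r r' s s' : Fin (n + 1) → Fin (n + 1) → Prop}

lemma isPreorder (h : IsVertexFamily P R) (hr : r ∈ R) : IsPreorder _ r :=
  (h.exists_vertex r hr).choose_spec.isPreorder

lemma normalCone_maxFace (h : IsVertexFamily P R) (hr : r ∈ R) {w : Fin n → ℝ}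
    (hw : w ∈ slicedCone r) :
    normalCone (maxFace P w) P = slicedCone (tieContraction r (consZero w)) :=
  (h.exists_vertex r hr).choose_spec.normalCone_maxFace hw

lemma maxFace_mem_faces (h : IsVertexFamily P R) (w : Fin n → ℝ) : maxFace P w ∈ faces P := by
  obtain ⟨r, hr, hw⟩ := h.exists_mem_slicedCone w
  obtain ⟨v, hv⟩ := h.exists_vertex r hr
  exact ⟨⟨v, hv.mem_maxFace hw⟩, w, rfl⟩

theorem mem_normalFan_iff (h : IsVertexFamily P R) {σ : Set (Fin n → ℝ)} :
    σ ∈ normalFan P ↔ ∃ s, (∃ r ∈ R, IsContraction s r) ∧ slicedCone s = σ := by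
  constructor
  · rintro ⟨F, ⟨-, w, rfl⟩, rfl⟩
    obtain ⟨r, hr, hw⟩ := h.exists_mem_slicedCone w
    have := h.isPreorder hr
    exact ⟨_, ⟨r, hr, isContraction_tieContraction hw⟩, (h.normalCone_maxFace hr hw).symm⟩
  · rintro ⟨s, ⟨r, hr, hs⟩, rfl⟩
    have := h.isPreorder hr
    have := hs.isPreorder
    obtain ⟨w, hw⟩ := exists_strictMonotoneAlong_consZero s
    refine ⟨maxFace P w, h.maxFace_mem_faces w, ?_⟩
    rw [h.normalCone_maxFace hr (slicedCone_anti hs.le hw.1), ← hs.eq_tieContraction hw]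

theorem slicedCone_subset_iff (h : IsVertexFamily P R) (hr : r ∈ R) (hs : IsContraction s r)
    (hr' : r' ∈ R) (hs' : IsContraction s' r') :
    slicedCone s ⊆ slicedCone s' ↔ IsContraction s s' := by
  refine ⟨fun hsub => ?_, fun hss' => slicedCone_anti hss'.le⟩
  have := h.isPreorder hr
  have := h.isPreorder hr'
  have := hs.isPreorder
  have := hs'.isPreorder
  obtain ⟨w, hw⟩ := exists_strictMonotoneAlong_consZero s
  have hws' : w ∈ slicedCone s' := hsub hw.1
  have hwr' : w ∈ slicedCone r' := slicedCone_anti hs'.le hws'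
  have hcone : slicedCone s = slicedCone (tieContraction r' (consZero w)) := by
    rw [← h.normalCone_maxFace hr' hwr', h.normalCone_maxFace hr (slicedCone_anti hs.le hw.1),
      ← hs.eq_tieContraction hw]
  rw [slicedCone_inj.1 hcone,
    ← tieContraction_eq_of_le (mem_slicedCone.1 hwr') hs'.le (hs'.le_tieContraction hws')]
  exact isContraction_tieContraction hws'

end IsVertexFamily

end Faces

/-! ### Preorders of skewed binary partitions -/

section SkewedBinary

variable {n : ℕ} {r s : Fin (n + 1) → Fin (n + 1) → Prop}

/-- The preorders of skewed binary partitions, intrinsically: incomparable elements have the same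
strict lower and upper sets, and only `0` and the elements above `0` have anything below them. -/
structure IsSkewedBinary (r : Fin (n + 1) → Fin (n + 1) → Prop) : Prop where
  isPreorder : IsPreorder _ r
  rel_left : ∀ {p q x}, ¬ r p q → ¬ r q p → x ≠ p → r x p → r x q
  rel_right : ∀ {p q x}, ¬ r p q → ¬ r q p → x ≠ p → r p x → r q x
  zero_rel : ∀ {x y}, r x y → x = y ∨ r 0 y

namespace IsSkewedBinary

lemma rel_left_of_contractsEdge (hr : IsSkewedBinary r) (h : ContractsEdge r s)
    {p q x : Fin (n + 1)} (hpq : ¬ s p q) (hqp : ¬ s q p) (hx : x ≠ p) (hxp : s x p) : s x q := by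
  have hle : r ≤ s := h.le
  obtain ⟨a, b, ⟨hab, -, -⟩, rfl⟩ := h
  induction hxp with
  | refl => exact absurd rfl hx
  | @tail y p hxy hyp ih =>
    rcases eq_or_ne y p with rfl | hne
    · exact ih hx hpq hqp
    have hpq' : ¬ r p q := fun h => hpq (hle p q h)
    have hqp' : ¬ r q p := fun h => hqp (hle q p h)
    rcases hyp with hyp | ⟨rfl, rfl⟩
    · exact hxy.tail (.inl (hr.rel_left hpq' hqp' hne hyp))
    · exact absurd (.tail (.single (.inl (hr.rel_right hpq' hqp' hne hab)))
        (.inr ⟨rfl, rfl⟩)) hqp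

lemma rel_right_of_contractsEdge (hr : IsSkewedBinary r) (h : ContractsEdge r s)
    {p q x : Fin (n + 1)} (hpq : ¬ s p q) (hqp : ¬ s q p) (hx : x ≠ p) (hpx : s p x) : s q x := by
  have hle : r ≤ s := h.le
  obtain ⟨a, b, ⟨hab, -, -⟩, rfl⟩ := h
  induction hpx using Relation.ReflTransGen.head_induction_on with
  | refl => exact absurd rfl hx
  | @head p y hpy hyx ih =>
    rcases eq_or_ne y p with rfl | hne
    · exact ih hx hpq hqp
    have hpq' : ¬ r p q := fun h => hpq (hle p q h)
    have hqp' : ¬ r q p := fun h => hqp (hle q p h)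
    rcases hpy with hpy | ⟨rfl, rfl⟩
    · exact hyx.head (.inl (hr.rel_right hpq' hqp' hne hpy))
    · exact absurd (.head (.inr ⟨rfl, rfl⟩)
        (.single (.inl (hr.rel_left hpq' hqp' hne hab)))) hpq

lemma zero_rel_of_contractsEdge (hr : IsSkewedBinary r) (h : ContractsEdge r s)
    {x y : Fin (n + 1)} (hxy : s x y) : x = y ∨ s 0 y := by
  obtain ⟨a, b, ⟨hab, -, -⟩, rfl⟩ := h
  induction hxy with
  | refl => exact .inl rfl
  | tail _ hyz ih =>
    rcases hyz with hyz | ⟨rfl, rfl⟩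
    · rcases hr.zero_rel hyz with rfl | h
      · exact ih
      · exact .inr (.single (.inl h))
    · rcases hr.zero_rel hab with rfl | h
      · exact ih
      · exact .inr (.tail (.single (.inl h)) (.inr ⟨rfl, rfl⟩))

lemma contractsEdge (hr : IsSkewedBinary r) (h : ContractsEdge r s) : IsSkewedBinary s :=
  ⟨h.isPreorder, hr.rel_left_of_contractsEdge h, hr.rel_right_of_contractsEdge h,
    hr.zero_rel_of_contractsEdge h⟩

lemma isContraction (hr : IsSkewedBinary r) (h : IsContraction s r) : IsSkewedBinary s := by
  induction h with
  | refl => exact hr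
  | tail _ h ih => exact ih.contractsEdge h

end IsSkewedBinary

end SkewedBinary

namespace SkewedBinaryPartition

variable {n : ℕ}

/-- The index of the block containing `p`. -/
noncomputable def idx (B : SkewedBinaryPartition n) (p : Fin (n + 1)) : Fin (B.k + 2) :=
  (B.cover p).choose

lemma mem_block_idx (B : SkewedBinaryPartition n) (p : Fin (n + 1)) : p ∈ B.block (B.idx p) :=
  (B.cover p).choose_spec

lemma mem_block_iff (B : SkewedBinaryPartition n) {p : Fin (n + 1)} {i : Fin (B.k + 2)} :
    p ∈ B.block i ↔ B.idx p = i := by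
  constructor
  · intro h
    by_contra hne
    exact Finset.disjoint_left.1 (B.disjoint _ _ hne) (B.mem_block_idx p) h
  · rintro rfl
    exact B.mem_block_idx p

lemma rel_iff (B : SkewedBinaryPartition n) {p q : Fin (n + 1)} :
    B.rel p q ↔ p = q ∨ B.idx p < B.idx q ∨ (B.idx p = B.idx q ∧ B.homog (B.idx p) = true) := by
  unfold rel
  simp only [mem_block_iff]
  constructor
  · rintro (h | ⟨i, j, rfl, rfl, h⟩)
    · exact .inl h
    · exact .inr h
  · rintro (h | h)
    · exact .inl h
    · exact .inr ⟨_, _, rfl, rfl, h⟩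

lemma isPreorder_rel (B : SkewedBinaryPartition n) : IsPreorder _ B.rel where
  refl p := .inl rfl
  trans p q r hpq hqr := by
    rw [rel_iff] at *
    rcases hpq with rfl | hpq | hpq
    · exact hqr
    · rcases hqr with rfl | hqr | hqr
      · exact .inr (.inl hpq)
      · exact .inr (.inl (hpq.trans hqr))
      · exact .inr (.inl (hqr.1 ▸ hpq))
    · rcases hqr with rfl | hqr | hqr
      · exact .inr (.inr hpq)
      · exact .inr (.inl (hpq.1 ▸ hqr))
      · exact .inr (.inr ⟨hpq.1.trans hqr.1, hpq.2⟩)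

lemma idx_lt_iff (B : SkewedBinaryPartition n) {p q : Fin (n + 1)} :
    B.idx p < B.idx q ↔ B.rel p q ∧ ¬ B.rel q p := by
  rw [rel_iff, rel_iff]
  constructor
  · intro h
    refine ⟨.inr (.inl h), ?_⟩
    rintro (rfl | h' | h')
    · exact lt_irrefl _ h
    · exact lt_asymm h h'
    · exact h.ne' h'.1
  · rintro ⟨rfl | h | h, h'⟩
    · exact absurd (.inl rfl) h'
    · exact h
    · exact absurd (.inr (.inr ⟨h.1.symm, h.1 ▸ h.2⟩)) h'

lemma idx_zero (B : SkewedBinaryPartition n) : B.idx 0 = 0 ∨ B.idx 0 = 1 := by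
  simpa only [mem_block_iff] using B.zero_mem

lemma idx_ne_one (B : SkewedBinaryPartition n) (h : B.idx 0 = 0) (p : Fin (n + 1)) :
    B.idx p ≠ 1 := by
  intro hp
  have hempty := (B.of_zero_mem_first (B.mem_block_iff.2 h)).2
  simpa [hempty] using B.mem_block_iff.2 hp

lemma rel_zero_of_idx_ne_zero (B : SkewedBinaryPartition n) {p : Fin (n + 1)}
    (hp : B.idx p ≠ 0) : B.rel 0 p := by
  rw [rel_iff]
  rcases B.idx_zero with h | h
  · exact .inr (.inl (h ▸ Fin.pos_of_ne_zero hp))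
  by_cases hp1 : B.idx p = 1
  · refine or_iff_not_imp_left.2 fun hne => .inr ⟨h.trans hp1.symm, h ▸ B.homog_second ?_⟩
    exact Finset.one_lt_card.2 ⟨0, B.mem_block_iff.2 h, p, B.mem_block_iff.2 hp1, hne⟩
  · refine .inr (.inl (h ▸ lt_of_le_of_ne ?_ (Ne.symm hp1)))
    exact Fin.le_def.2 (Nat.one_le_iff_ne_zero.2 (Fin.val_ne_zero_iff.2 hp))

lemma isSkewedBinary_rel (B : SkewedBinaryPartition n) : IsSkewedBinary B.rel := by
  have hsame : ∀ {p q}, ¬ B.rel p q → ¬ B.rel q p →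
      B.idx p = B.idx q ∧ ¬ B.homog (B.idx p) = true := by
    intro p q hpq hqp
    simp only [rel_iff, not_or, not_and, not_lt] at hpq hqp
    have heq := hqp.2.1.antisymm hpq.2.1
    exact ⟨heq, hpq.2.2 heq⟩
  refine ⟨B.isPreorder_rel, fun {p q x} hpq hqp hx hxp => ?_, fun {p q x} hpq hqp hx hpx => ?_,
    fun {x y} hxy => ?_⟩
  · obtain ⟨heq, hh⟩ := hsame hpq hqp
    rcases B.rel_iff.1 hxp with h | h | ⟨h, h'⟩
    · exact absurd h hx
    · exact B.rel_iff.2 (.inr (.inl (heq ▸ h)))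
    · exact absurd (h ▸ h') hh
  · obtain ⟨heq, hh⟩ := hsame hpq hqp
    rcases B.rel_iff.1 hpx with h | h | ⟨-, h'⟩
    · exact absurd h.symm hx
    · exact B.rel_iff.2 (.inr (.inl (heq ▸ h)))
    · exact absurd h' hh
  · rcases B.rel_iff.1 hxy with h | h | ⟨h, h'⟩
    · exact .inl h
    · exact .inr (B.rel_zero_of_idx_ne_zero (Fin.ne_zero_of_lt h))
    · refine .inr (B.rel_zero_of_idx_ne_zero fun h0 => ?_)
      rw [h, h0, B.homog_first] at h'
      exact Bool.false_ne_true h'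

lemma two_le_idx_iff (B : SkewedBinaryPartition n) (p : Fin (n + 1)) :
    2 ≤ (B.idx p : ℕ) ↔ B.idx 0 < B.idx p := by
  have hval : ((1 : Fin (B.k + 2)) : ℕ) = 1 := rfl
  rw [Fin.lt_def]
  rcases B.idx_zero with h | h
  · have hne : (B.idx p : ℕ) ≠ 1 := fun h' => B.idx_ne_one h p (Fin.ext h')
    rw [h, Fin.val_zero]
    omega
  · rw [h, hval]
    omega

lemma idx_zero_eq_zero_iff (B : SkewedBinaryPartition n) :
    B.idx 0 = 0 ↔ ∃ p, ¬ B.rel p 0 ∧ ¬ B.rel 0 p := by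
  constructor
  · intro h
    obtain ⟨p, hp, hp0⟩ :=
      Finset.exists_mem_ne (B.of_zero_mem_first (B.mem_block_iff.2 h)).1 0
    rw [mem_block_iff] at hp
    refine ⟨p, ?_, ?_⟩ <;> simp [rel_iff, h, hp, hp0, hp0.symm, B.homog_first]
  · rintro ⟨p, hp0, h0p⟩
    by_contra h
    refine h0p (B.rel_zero_of_idx_ne_zero fun hp => hp0 (B.rel_iff.2 (.inr (.inl ?_))))
    exact hp ▸ Fin.pos_of_ne_zero h

lemma exists_idx_eq (B : SkewedBinaryPartition n) (i : ℕ) (hi : i < B.k) :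
    ∃ p, (B.idx p : ℕ) = i + 2 := by
  obtain ⟨p, hp⟩ := B.nonempty ⟨i, hi⟩
  exact ⟨p, by rw [B.mem_block_iff.1 hp]; simp⟩

lemma idx_le_of_rel_eq {B B' : SkewedBinaryPartition n} (h : B.rel = B'.rel) (i : ℕ) :
    ∀ p, (B.idx p : ℕ) = i + 2 → i + 2 ≤ (B'.idx p : ℕ) := by
  induction i with
  | zero =>
    intro p hp
    have h1 := (B.two_le_idx_iff p).1 hp.ge
    rw [idx_lt_iff, h, ← idx_lt_iff, ← two_le_idx_iff] at h1
    exact h1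
  | succ i ih =>
    intro p hp
    obtain ⟨q, hq⟩ := B.exists_idx_eq i (by have := (B.idx p).2; omega)
    have h1 : B.idx q < B.idx p := by rw [Fin.lt_def]; omega
    rw [idx_lt_iff, h, ← idx_lt_iff, Fin.lt_def] at h1
    have := ih q hq
    omega

lemma k_le_of_rel_eq {B B' : SkewedBinaryPartition n} (h : B.rel = B'.rel) : B.k ≤ B'.k := by
  by_contra hcon
  obtain ⟨p, hp⟩ := B.exists_idx_eq (B.k - 1) (by omega)
  have := idx_le_of_rel_eq h _ p hp
  have := (B'.idx p).2
  omega

lemma idx_eq_of_rel_eq {B B' : SkewedBinaryPartition n} (h : B.rel = B'.rel)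
    (p : Fin (n + 1)) : (B.idx p : ℕ) = B'.idx p := by
  have hzero : (B.idx 0 : ℕ) = B'.idx 0 := by
    have h0 := B.idx_zero_eq_zero_iff
    rw [h, ← idx_zero_eq_zero_iff] at h0
    rcases B.idx_zero with hB | hB
    · rw [hB, h0.1 hB]; rfl
    · rcases B'.idx_zero with hB' | hB'
      · rw [h0.2 hB'] at hB; simp at hB
      · rw [hB, hB']; rfl
  have hiff : 2 ≤ (B.idx p : ℕ) ↔ 2 ≤ (B'.idx p : ℕ) := by
    rw [two_le_idx_iff, two_le_idx_iff, idx_lt_iff, idx_lt_iff, h]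
  by_cases h2 : 2 ≤ (B.idx p : ℕ)
  · have h2' := hiff.1 h2
    have h3 := idx_le_of_rel_eq h ((B.idx p : ℕ) - 2) p (by omega)
    have h4 := idx_le_of_rel_eq h.symm ((B'.idx p : ℕ) - 2) p (by omega)
    omega
  · have h2' : ¬ 2 ≤ (B'.idx p : ℕ) := fun h' => h2 (hiff.2 h')
    have hlt : B.idx p < B.idx 0 ↔ B'.idx p < B'.idx 0 := by
      rw [idx_lt_iff, idx_lt_iff, h]
    have hgt : B.idx 0 < B.idx p ↔ B'.idx 0 < B'.idx p := by
      rw [idx_lt_iff, idx_lt_iff, h]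
    have h0 : (B.idx 0 : ℕ) ≤ 1 := by
      rcases B.idx_zero with hB | hB <;> rw [hB]
      · exact zero_le_one
      · exact le_rfl
    rw [Fin.lt_def, Fin.lt_def] at hlt hgt
    omega

lemma homog_iff (B : SkewedBinaryPartition n) (i : Fin (B.k + 2)) :
    B.homog i = true ↔ ∃ p q, p ≠ q ∧ B.idx p = i ∧ B.idx q = i ∧ B.rel p q := by
  constructor
  · intro h
    obtain ⟨p, hp, q, hq, hpq⟩ := Finset.one_lt_card.1 (B.two_le_of_homog i h)
    rw [mem_block_iff] at hp hq
    exact ⟨p, q, hpq, hp, hq, B.rel_iff.2 (.inr (.inr ⟨hp.trans hq.symm, hp ▸ h⟩))⟩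
  · rintro ⟨p, q, hpq, rfl, hq, h⟩
    rcases B.rel_iff.1 h with h | h | h
    · exact absurd h hpq
    · exact absurd hq h.ne'
    · exact h.2

theorem rel_injective : Function.Injective (rel : SkewedBinaryPartition n → _) := by
  intro B B' h
  have hk := le_antisymm (k_le_of_rel_eq h) (k_le_of_rel_eq h.symm)
  have hidx := idx_eq_of_rel_eq h
  have hb : ∀ (i : Fin (B.k + 2)) (i' : Fin (B'.k + 2)), (i : ℕ) = (i' : ℕ) →
      B.block i = B'.block i' := by
    intro i i' hi
    ext p
    rw [mem_block_iff, mem_block_iff, Fin.ext_iff, Fin.ext_iff, hidx, hi]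
  have hh : ∀ (i : Fin (B.k + 2)) (i' : Fin (B'.k + 2)), (i : ℕ) = (i' : ℕ) →
      B.homog i = B'.homog i' := by
    intro i i' hi
    rw [Bool.eq_iff_iff, homog_iff, homog_iff]
    simp only [Fin.ext_iff, hidx, hi, h]
  cases B
  cases B'
  dsimp only at hk hb hh
  subst hk
  congr
  · funext i; exact hb i i rfl
  · funext i; exact hh i i rfl

end SkewedBinaryPartition

section Levels

variable {n : ℕ} {f : Fin n → ℝ}

lemma mem_dataVector {x : ℝ} : x ∈ dataVector f ↔ 0 < x ∧ ∃ i, f i = x := by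
  simp only [dataVector, Finset.mem_sort, Finset.mem_filter, Finset.mem_image, Finset.mem_univ,
    true_and]
  exact and_comm

lemma sortedLT_dataVector (f : Fin n → ℝ) : (dataVector f).SortedLT := Finset.sortedLT_sort _

lemma dataVector_get_pos (i : Fin (dataVector f).length) : 0 < (dataVector f).get i :=
  (mem_dataVector.1 (List.get_mem _ i)).1

/-- The levels `-1 < 0 < d_1 < ⋯ < d_ℓ`, where `d` lists the positive values of `f`. The blocks of
a skewed binary partition are the fibres of a function over these levels, with `-1` and `0`
belonging to the blocks `B_{-1}` and `B_0`. -/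
noncomputable def levels (f : Fin n → ℝ) : Fin ((dataVector f).length + 2) → ℝ :=
  Fin.cons (-1) (Fin.cons 0 (dataVector f).get)

@[simp] lemma levels_zero : levels f 0 = -1 := rfl

@[simp] lemma levels_one : levels f 1 = 0 := rfl

@[simp] lemma levels_succ_succ (i : Fin (dataVector f).length) :
    levels f i.succ.succ = (dataVector f).get i := rfl

lemma strictMono_levels (f : Fin n → ℝ) : StrictMono (levels f) := by
  refine Fin.strictMono_cons.2 ⟨fun j => ?_, Fin.strictMono_cons.2
    ⟨dataVector_get_pos, (sortedLT_dataVector f).strictMono_get⟩⟩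
  cases j using Fin.cases with
  | zero => simp
  | succ j => simpa using (neg_one_lt_zero.trans (dataVector_get_pos j))

lemma exists_levels_eq {p : Fin n} (hp : f p = -1 ∨ 0 ≤ f p) : ∃ i, levels f i = f p := by
  rcases hp with hp | hp
  · exact ⟨0, hp.symm⟩
  rcases hp.eq_or_lt with hp | hp
  · exact ⟨1, hp⟩
  · obtain ⟨i, hi⟩ := List.get_of_mem (mem_dataVector.2 ⟨hp, p, rfl⟩)
    exact ⟨i.succ.succ, hi⟩

/-- The fibre of `f` over `t`. -/
noncomputable def levelBlock (f : Fin n → ℝ) (t : ℝ) : Finset (Fin n) :=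
  Finset.univ.filter fun p => f p = t

@[simp] lemma mem_levelBlock {p : Fin n} {t : ℝ} : p ∈ levelBlock f t ↔ f p = t := by
  simp [levelBlock]

end Levels

/-- The function `f` on `[0, n]` is constant on the blocks of a skewed binary partition and
increases with their index; it takes the value `-1` on `B_{-1}` and `0` on `B_0`, and `H` says
which values belong to homogeneous blocks (those of one element excepted). -/
structure IsSkewedLevel {n : ℕ} (f : Fin (n + 1) → ℝ) (H : ℝ → Prop) : Prop where
  range : ∀ p, f p = -1 ∨ 0 ≤ f p
  zero : f 0 = -1 ∨ f 0 = 0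
  exists_ne_zero : f 0 = -1 → ∃ p, p ≠ 0 ∧ f p = -1
  ne_zero : f 0 = -1 → ∀ p, f p ≠ 0
  not_homog : ¬ H (-1)
  homog : H 0

namespace SkewedBinaryPartition

variable {n : ℕ} {f : Fin (n + 1) → ℝ} {H : ℝ → Prop}

open scoped Classical in
/-- The skewed binary partition whose blocks are the fibres of `f`. -/
noncomputable def ofLevel (h : IsSkewedLevel f H) : SkewedBinaryPartition n where
  k := (dataVector f).length
  block i := levelBlock f (levels f i)
  homog i := decide (H (levels f i) ∧ 2 ≤ (levelBlock f (levels f i)).card)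
  disjoint i j hij := Finset.disjoint_left.2 fun p hi hj =>
    hij ((strictMono_levels f).injective ((mem_levelBlock.1 hi).symm.trans (mem_levelBlock.1 hj)))
  cover p := by simpa [eq_comm] using exists_levels_eq (h.range p)
  homog_first := by simp [h.not_homog]
  homog_second hc := by simpa [h.homog] using hc
  zero_mem := by simpa using h.zero
  of_zero_mem_first h0 := by
    rw [levels_zero, mem_levelBlock] at h0
    obtain ⟨p, hp, hfp⟩ := h.exists_ne_zero h0
    exact ⟨Finset.one_lt_card.2 ⟨p, by simpa using hfp, 0, by simpa using h0, hp⟩,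
      Finset.eq_empty_iff_forall_notMem.2 fun p hp => h.ne_zero h0 p (mem_levelBlock.1 hp)⟩
  two_le_of_homog i hi := (of_decide_eq_true hi).2
  nonempty i := by
    obtain ⟨-, p, hp⟩ := mem_dataVector.1 (List.get_mem (dataVector f) i)
    exact ⟨p, by simpa using hp⟩

lemma mem_block_ofLevel (h : IsSkewedLevel f H) {p : Fin (n + 1)} {i} :
    p ∈ (ofLevel h).block i ↔ f p = levels f i := by
  simp [ofLevel]

lemma levels_idx_ofLevel (h : IsSkewedLevel f H) (p : Fin (n + 1)) :
    levels f ((ofLevel h).idx p) = f p :=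
  ((mem_block_ofLevel h).1 (mem_block_idx _ p)).symm

open scoped Classical in
lemma homog_ofLevel_iff (h : IsSkewedLevel f H) {i} :
    (ofLevel h).homog i = true ↔ H (levels f i) ∧ 2 ≤ ((ofLevel h).block i).card :=
  decide_eq_true_iff

lemma rel_ofLevel_iff (h : IsSkewedLevel f H) {p q : Fin (n + 1)} :
    (ofLevel h).rel p q ↔ p = q ∨ f p < f q ∨ (f p = f q ∧ H (f p)) := by
  have hlt : (ofLevel h).idx p < (ofLevel h).idx q ↔ f p < f q := by
    rw [← levels_idx_ofLevel h p, ← levels_idx_ofLevel h q]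
    exact (strictMono_levels f).lt_iff_lt.symm
  have heq : (ofLevel h).idx p = (ofLevel h).idx q ↔ f p = f q := by
    rw [← levels_idx_ofLevel h p, ← levels_idx_ofLevel h q]
    exact (strictMono_levels f).injective.eq_iff.symm
  rw [rel_iff, hlt, heq]
  refine or_congr_right' fun hpq => or_congr_right (and_congr_right fun hf => ?_)
  have hcard : 2 ≤ ((ofLevel h).block ((ofLevel h).idx p)).card :=
    Finset.one_lt_card.2 ⟨p, mem_block_idx _ p, q, (mem_block_iff _).2 (heq.2 hf).symm, hpq⟩
  rw [homog_ofLevel_iff, and_iff_left hcard, levels_idx_ofLevel]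

end SkewedBinaryPartition

open scoped Classical in
/-- The number of elements strictly below `p` in the preorder `r`. -/
noncomputable def strictRank {n : ℕ} (r : Fin n → Fin n → Prop) (p : Fin n) : ℕ :=
  (Finset.univ.filter fun x => r x p ∧ ¬ r p x).card

open scoped Classical in
/-- The function whose fibres are the blocks of the skewed binary partition with preorder `r`:
it is positive above `0`, and elsewhere it takes the values `-1` on `B_{-1}` and `0` on `B_0`. -/
noncomputable def skewedLevel {n : ℕ} (r : Fin (n + 1) → Fin (n + 1) → Prop)
    (p : Fin (n + 1)) : ℝ :=
  if r 0 p ∧ ¬ r p 0 then strictRank r p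
  else if r 0 p ∧ ∀ q, r 0 q ∨ r q 0 then 0
  else -1

namespace IsSkewedBinary

variable {n : ℕ} {r : Fin (n + 1) → Fin (n + 1) → Prop} {p q x : Fin (n + 1)}

lemma eq_of_rel_of_rel (hr : IsSkewedBinary r) (hpq : ¬ r p q) (hqp : ¬ r q p) (hxp : r x p)
    (hpx : r p x) : x = p := by
  have := hr.isPreorder
  by_contra hne
  exact hpq (_root_.trans hpx (hr.rel_left hpq hqp hne hxp))

lemma strictRank_lt_iff (hr : IsSkewedBinary r) :
    strictRank r p < strictRank r q ↔ r p q ∧ ¬ r q p := by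
  classical
  have := hr.isPreorder
  constructor
  · intro h
    by_contra hpq
    refine h.not_ge (Finset.card_le_card fun x => ?_)
    simp only [Finset.mem_filter, Finset.mem_univ, true_and, and_imp]
    intro hxq hqx
    by_cases hqp : r q p
    · exact ⟨_root_.trans hxq hqp, fun hpx => hqx (_root_.trans hqp hpx)⟩
    · have hpq' : ¬ r p q := fun h => hpq ⟨h, hqp⟩
      refine ⟨hr.rel_left hqp hpq' ?_ hxq, fun hpx => hpq' (_root_.trans hpx hxq)⟩
      rintro rfl
      exact hqx (refl x)
  · rintro ⟨hpq, hqp⟩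
    refine Finset.card_lt_card (Finset.ssubset_iff_of_subset (fun x => ?_) |>.2 ⟨p, ?_, ?_⟩)
    · simp only [Finset.mem_filter, Finset.mem_univ, true_and, and_imp]
      exact fun hxp hpx => ⟨_root_.trans hxp hpq, fun hqx => hpx (_root_.trans hpq hqx)⟩
    · simp [hpq, hqp]
    · simp

lemma skewedLevel_pos_iff (hr : IsSkewedBinary r) :
    0 < skewedLevel r p ↔ r 0 p ∧ ¬ r p 0 := by
  unfold skewedLevel
  split_ifs with h h'
  · simpa [h] using (Nat.zero_le _).trans_lt (hr.strictRank_lt_iff.2 h)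
  · simp [h]
  · simp [h]

lemma skewedLevel_eq_zero_iff (hr : IsSkewedBinary r) :
    skewedLevel r p = 0 ↔ r 0 p ∧ r p 0 ∧ ∀ q, r 0 q ∨ r q 0 := by
  have hpos := hr.skewedLevel_pos_iff (p := p)
  unfold skewedLevel at hpos ⊢
  split_ifs at hpos ⊢ with h h'
  · exact iff_of_false (hpos.2 h).ne' fun h' => h.2 h'.2.1
  · exact iff_of_true rfl ⟨h'.1, by tauto, h'.2⟩
  · exact iff_of_false (by norm_num) (by tauto)

lemma skewedLevel_eq_neg_one (hr : IsSkewedBinary r) (h : skewedLevel r p ≤ 0)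
    (h' : skewedLevel r p ≠ 0) : skewedLevel r p = -1 := by
  have := hr.skewedLevel_pos_iff (p := p)
  unfold skewedLevel at *
  split_ifs at * with h1 h2
  · exact absurd (this.2 h1) h.not_gt
  · exact absurd rfl h'
  · rfl

lemma rel_of_skewedLevel_nonpos (hr : IsSkewedBinary r) (hp : skewedLevel r p ≤ 0)
    (hq : 0 < skewedLevel r q) : r p q ∧ ¬ r q p := by
  have := hr.isPreorder
  rw [hr.skewedLevel_pos_iff] at hq
  rw [← not_lt, hr.skewedLevel_pos_iff] at hp
  have hqp : ¬ r q p := by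
    intro h
    rcases hr.zero_rel h with rfl | h0p
    · exact hp hq
    · exact hq.2 (_root_.trans h (by tauto))
  by_cases hp0 : r p 0
  · exact ⟨_root_.trans hp0 hq.1, hqp⟩
  · refine ⟨hr.rel_right (p := 0) (by tauto) hp0 ?_ hq.1, hqp⟩
    rintro rfl
    exact hq.2 hq.1

lemma rel_iff_of_skewedLevel_nonpos (hr : IsSkewedBinary r) (hp : skewedLevel r p ≤ 0)
    (hq : skewedLevel r q ≤ 0) :
    r p q ∧ ¬ r q p ↔ skewedLevel r p ≠ 0 ∧ skewedLevel r q = 0 := by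
  have := hr.isPreorder
  rw [← not_lt, hr.skewedLevel_pos_iff] at hp hq
  rw [Ne, hr.skewedLevel_eq_zero_iff, hr.skewedLevel_eq_zero_iff]
  constructor
  · rintro ⟨hpq, hqp⟩
    have h0q : r 0 q := (hr.zero_rel hpq).resolve_left fun h => hqp (h ▸ refl _)
    have hq0 : r q 0 := by tauto
    have h0p : ¬ r 0 p := fun h => hqp (_root_.trans hq0 h)
    have hp0 : r p 0 := _root_.trans hpq hq0
    refine ⟨fun h => h0p h.1, h0q, hq0, fun x => ?_⟩
    by_contra! hx
    rcases hr.zero_rel (hr.rel_left hx.1 hx.2 (fun h => h0p (h ▸ refl _)) hp0) with rfl | h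
    · exact hx.2 hp0
    · exact hx.1 h
  · rintro ⟨hp', h0q, hq0, hcomp⟩
    have h0p : ¬ r 0 p := fun h => hp' ⟨h, by tauto, hcomp⟩
    exact ⟨_root_.trans ((hcomp p).resolve_left h0p) h0q, fun h => h0p (_root_.trans h0q h)⟩

lemma skewedLevel_lt_iff (hr : IsSkewedBinary r) :
    skewedLevel r p < skewedLevel r q ↔ r p q ∧ ¬ r q p := by
  have := hr.isPreorder
  rcases lt_or_ge 0 (skewedLevel r p) with hp | hp <;>
    rcases lt_or_ge 0 (skewedLevel r q) with hq | hq
  · rw [hr.skewedLevel_pos_iff] at hp hq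
    rw [skewedLevel, skewedLevel, if_pos hp, if_pos hq, Nat.cast_lt, hr.strictRank_lt_iff]
  · exact iff_of_false (hq.trans hp.le).not_gt fun h =>
      h.2 (hr.rel_of_skewedLevel_nonpos hq hp).1
  · exact iff_of_true (hp.trans_lt hq) (hr.rel_of_skewedLevel_nonpos hp hq)
  · rw [hr.rel_iff_of_skewedLevel_nonpos hp hq]
    constructor
    · intro h
      have hp' := (h.trans_le hq).ne
      refine ⟨hp', of_not_not fun hq' => h.ne ?_⟩
      rw [hr.skewedLevel_eq_neg_one hp hp', hr.skewedLevel_eq_neg_one hq hq']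
    · exact fun h => h.2 ▸ lt_of_le_of_ne hp h.1

/-- The levels of `skewedLevel r` that belong to a homogeneous block. -/
def IsHomogeneousLevel (r : Fin (n + 1) → Fin (n + 1) → Prop) (t : ℝ) : Prop :=
  t = 0 ∨ ∃ p q, p ≠ q ∧ skewedLevel r p = t ∧ r p q ∧ r q p

lemma exists_incomparable_zero (hr : IsSkewedBinary r) (h0p : r 0 p) (hp0 : r p 0)
    (hp : skewedLevel r p ≠ 0) : ∃ x, ¬ r 0 x ∧ ¬ r x 0 := by
  by_contra! hcomp
  exact hp (hr.skewedLevel_eq_zero_iff.2 ⟨h0p, hp0, fun q => or_iff_not_imp_left.2 (hcomp q)⟩)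

lemma isSkewedLevel (hr : IsSkewedBinary r) :
    IsSkewedLevel (skewedLevel r) (IsHomogeneousLevel r) := by
  have := hr.isPreorder
  have h00 : skewedLevel r 0 ≤ 0 :=
    not_lt.1 fun h => (hr.skewedLevel_pos_iff.1 h).2 (refl 0)
  have hzero : skewedLevel r 0 = -1 → ∃ p, ¬ r 0 p ∧ ¬ r p 0 := fun h =>
    hr.exists_incomparable_zero (refl 0) (refl 0) (by norm_num [h])
  refine ⟨fun p => ?_, ?_, fun h => ?_, fun h p hp => ?_, ?_, .inl rfl⟩
  · rcases le_or_gt 0 (skewedLevel r p) with hp | hp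
    · exact .inr hp
    · exact .inl (hr.skewedLevel_eq_neg_one hp.le hp.ne)
  · exact or_iff_not_imp_right.2 (hr.skewedLevel_eq_neg_one h00)
  · obtain ⟨p, h0p, hp0⟩ := hzero h
    refine ⟨p, fun hp => hp0 (hp ▸ refl _), hr.skewedLevel_eq_neg_one (not_lt.1 fun hp => ?_)
      fun hp => ?_⟩
    · exact h0p (hr.skewedLevel_pos_iff.1 hp).1
    · exact h0p (hr.skewedLevel_eq_zero_iff.1 hp).1
  · obtain ⟨q, h0q, hq0⟩ := hzero h
    exact ((hr.skewedLevel_eq_zero_iff.1 hp).2.2 q).elim h0q hq0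
  · rintro (h | ⟨p, q, hpq, hp, hrpq, hrqp⟩)
    · norm_num at h
    have h0p := (hr.zero_rel hrqp).resolve_left hpq.symm
    have h0q := (hr.zero_rel hrpq).resolve_left hpq
    have hp0 : r p 0 := by
      by_contra h
      linarith [hr.skewedLevel_pos_iff.2 ⟨h0p, h⟩]
    obtain ⟨x, h0x, hx0⟩ := hr.exists_incomparable_zero h0p hp0 (by norm_num [hp])
    exact hpq ((hr.eq_of_rel_of_rel h0x hx0 hp0 h0p).trans
      (hr.eq_of_rel_of_rel h0x hx0 (_root_.trans hrqp hp0) h0q).symm)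

lemma rel_of_isHomogeneousLevel (hr : IsSkewedBinary r)
    (hpq : skewedLevel r p = skewedLevel r q) (h : IsHomogeneousLevel r (skewedLevel r p)) :
    r p q := by
  have := hr.isPreorder
  have hequiv : ∀ {a b}, skewedLevel r a = skewedLevel r b → r a b → r b a := fun hab h => by
    by_contra h'
    exact (hr.skewedLevel_lt_iff.2 ⟨h, h'⟩).ne hab
  rcases h with h | ⟨a, b, hab, ha, hrab, hrba⟩
  · exact _root_.trans (hr.skewedLevel_eq_zero_iff.1 h).2.1
      (hr.skewedLevel_eq_zero_iff.1 (hpq ▸ h)).1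
  by_contra hrpq
  have hrqp : ¬ r q p := fun h => hrpq (hequiv hpq.symm h)
  by_cases hrap : r a p
  · have hrpa := hequiv ha hrap
    exact hab ((hr.eq_of_rel_of_rel hrpq hrqp hrap hrpa).trans
      (hr.eq_of_rel_of_rel hrpq hrqp (_root_.trans hrba hrap) (_root_.trans hrpa hrab)).symm)
  · exact hab (hr.eq_of_rel_of_rel hrap (fun h => hrap (hequiv ha.symm h)) hrba hrab).symm

theorem exists_rel_eq (hr : IsSkewedBinary r) : ∃ B : SkewedBinaryPartition n, B.rel = r := by
  have := hr.isPreorder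
  refine ⟨.ofLevel hr.isSkewedLevel, ?_⟩
  ext p q
  rw [SkewedBinaryPartition.rel_ofLevel_iff, hr.skewedLevel_lt_iff]
  constructor
  · rintro (rfl | h | h)
    · exact refl p
    · exact h.1
    · exact hr.rel_of_isHomogeneousLevel h.1 h.2
  · intro hpq
    by_cases hqp : r q p
    · refine or_iff_not_imp_left.2 fun hne => .inr ⟨?_, .inr ⟨p, q, hne, rfl, hpq, hqp⟩⟩
      refine le_antisymm (not_lt.1 fun h => ?_) (not_lt.1 fun h => ?_)
      · exact (hr.skewedLevel_lt_iff.1 h).2 hpq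
      · exact (hr.skewedLevel_lt_iff.1 h).2 hqp
    · exact .inr (.inl ⟨hpq, hqp⟩)

end IsSkewedBinary

/-! ### Vertices of parking function polytopes -/

lemma exists_forall_iff_val_lt {n : ℕ} {p : Fin n → Prop} (hp : Antitone p) :
    ∃ K ≤ n, ∀ i : Fin n, p i ↔ (i : ℕ) < K := by
  classical
  by_cases hn : ∃ K, ∃ h : K < n, ¬ p ⟨K, h⟩
  · refine ⟨Nat.find hn, (Nat.find_spec hn).1.le, fun i => ⟨fun hi => ?_, fun hi => ?_⟩⟩
    · by_contra hlt
      exact (Nat.find_spec hn).2 (hp (not_lt.1 hlt) hi)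
    · by_contra hi'
      exact Nat.find_min hn hi ⟨i.2, hi'⟩
  · push Not at hn
    exact ⟨n, le_rfl, fun i => iff_of_true (hn i i.2) i.2⟩

section ParkingFunction

variable {n : ℕ} {u a : Fin n → ℝ}

lemma isParkingFunction_iff (hu : Monotone u) :
    IsParkingFunction u a ↔ (∀ i, 0 ≤ a i) ∧ ∃ σ : Equiv.Perm (Fin n), ∀ i, a i ≤ u (σ i) := by
  refine and_congr_right fun _ => ⟨fun h => ⟨(Tuple.sort a)⁻¹, fun i => ?_⟩, ?_⟩
  · simpa using h ((Tuple.sort a)⁻¹ i)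
  rintro ⟨σ, hσ⟩ i
  obtain ⟨j, hij, hji⟩ : ∃ j, i ≤ j ∧ σ (Tuple.sort a j) ≤ i := by
    by_contra! h
    have hcard := Finset.card_le_card_of_injOn (s := Finset.Ici i) (t := Finset.Ioi i)
      (fun j => σ (Tuple.sort a j)) (fun j hj => by simpa using h j (by simpa using hj))
      (σ.injective.comp (Tuple.sort a).injective).injOn
    rw [Fin.card_Ici, Fin.card_Ioi] at hcard
    omega
  calc a (Tuple.sort a i) ≤ a (Tuple.sort a j) := Tuple.monotone_sort a hij
    _ ≤ u (σ (Tuple.sort a j)) := hσ _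
    _ ≤ u i := hu hji

lemma mem_PF_of_le_perm (hu : Monotone u) (ha : ∀ i, 0 ≤ a i) (σ : Equiv.Perm (Fin n))
    (h : ∀ i, a i ≤ u (σ i)) : a ∈ PF u :=
  subset_convexHull ℝ _ ((isParkingFunction_iff hu).2 ⟨ha, σ, h⟩)

lemma dotProduct_le_of_mem_PF (hu : Monotone u) {w y : Fin n → ℝ} {τ : Equiv.Perm (Fin n)}
    (hw : Monovary (w ⊔ 0) (u ∘ τ)) (hy : y ∈ PF u) : w ⬝ᵥ y ≤ (w ⊔ 0) ⬝ᵥ (u ∘ τ) := by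
  suffices PF u ⊆ {y | w ⬝ᵥ y ≤ (w ⊔ 0) ⬝ᵥ (u ∘ τ)} from this hy
  refine convexHull_min (fun a ha => ?_) (convex_halfSpace_le ⟨dotProduct_add w, ?_⟩ _)
  · obtain ⟨ha0, σ, hσ⟩ := (isParkingFunction_iff hu).1 ha
    calc w ⬝ᵥ a ≤ (w ⊔ 0) ⬝ᵥ a := dotProduct_le_dotProduct_of_nonneg_right le_sup_left ha0
      _ ≤ (w ⊔ 0) ⬝ᵥ (u ∘ σ) := dotProduct_le_dotProduct_of_nonneg_left hσ le_sup_right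
      _ = ∑ i, (w ⊔ 0) i * (u ∘ τ) ((τ⁻¹ * σ) i) := by simp [dotProduct]
      _ ≤ (w ⊔ 0) ⬝ᵥ (u ∘ τ) := hw.sum_mul_comp_perm_le_sum_mul
  · exact fun c x => dotProduct_smul c w x

end ParkingFunction

/-- The relation on the domain of `f` in which distinct points of equal level are incomparable. -/
def levelOrder {α : Type*} (f : α → ℝ) (p q : α) : Prop := p = q ∨ f p < f q

instance {α : Type*} (f : α → ℝ) : IsPreorder α (levelOrder f) where
  refl _ := .inl rfl
  trans p q r hpq hqr := by
    rcases hpq with rfl | hpq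
    · exact hqr
    rcases hqr with rfl | hqr
    · exact .inr hpq
    · exact .inr (hpq.trans hqr)

section Chamber

variable {n : ℕ} {u : Fin n → ℝ} {K : ℕ} {τ : Equiv.Perm (Fin n)}

/-- The number `m_0` of zeros of `u`. -/
noncomputable def zeroCount (u : Fin n → ℝ) : ℕ := (Finset.univ.filter fun i => u i = 0).card

/-- The vector `(0, …, 0, u_{K+1}, …, u_n)` of the last entries of `u` (in the paper's indexing). -/
def truncate (u : Fin n → ℝ) (K : ℕ) (i : Fin n) : ℝ := if K ≤ (i : ℕ) then u i else 0

/-- The levels on `[0, n]` whose order describes `PF(u)` near the vertex `truncate u K ∘ τ`.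
The coordinates at which the vertex vanishes have level `-1`, the others have the level given by
the vertex. If the vanishing coordinates are forced by the zeros of `u`, they may change sign in
the normal cone, and then `0` also has level `-1`. -/
noncomputable def chamberLevel (u : Fin n → ℝ) (K : ℕ) (τ : Equiv.Perm (Fin n)) :
    Fin (n + 1) → ℝ :=
  Fin.cons (if K = zeroCount u ∧ 0 < K then -1 else 0)
    fun p => if K ≤ (τ p : ℕ) then u (τ p) else -1

lemma zeroCount_le_iff (hu : Monotone u) (hu0 : ∀ i, 0 ≤ u i) {i : Fin n} :
    zeroCount u ≤ i ↔ 0 < u i := by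
  obtain ⟨m, hm, hum⟩ := exists_forall_iff_val_lt (p := fun i => u i = 0)
    fun i j hij hj => le_antisymm (hj ▸ hu hij) (hu0 i)
  have : zeroCount u = m := by
    simp only [zeroCount, hum, Fin.card_filter_val_lt, min_eq_right hm]
  rw [this, ← not_lt, ← hum, (hu0 i).lt_iff_ne, ne_comm]

lemma chamberLevel_zero_lt_succ (hu : Monotone u) (hu0 : ∀ i, 0 ≤ u i) (hK : zeroCount u ≤ K)
    {q : Fin n} : chamberLevel u K τ 0 < chamberLevel u K τ q.succ ↔ K ≤ τ q := by
  have hpos : K ≤ τ q → 0 < u (τ q) := fun h => (zeroCount_le_iff hu hu0).1 (hK.trans h)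
  simp only [chamberLevel, Fin.cons_zero, Fin.cons_succ]
  split_ifs with h h' h'
  · exact iff_of_true (by linarith [hpos h']) h'
  · exact iff_of_false (lt_irrefl _) h'
  · exact iff_of_true (hpos h') h'
  · exact iff_of_false (by norm_num) h'

lemma chamberLevel_succ_lt_zero (hu : Monotone u) (hu0 : ∀ i, 0 ≤ u i) (hK : zeroCount u ≤ K)
    {p : Fin n} :
    chamberLevel u K τ p.succ < chamberLevel u K τ 0 ↔ (τ p : ℕ) < K ∧ zeroCount u < K := by
  have hpos : K ≤ τ p → 0 < u (τ p) := fun h => (zeroCount_le_iff hu hu0).1 (hK.trans h)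
  simp only [chamberLevel, Fin.cons_zero, Fin.cons_succ]
  split_ifs with h h' h'
  · exact iff_of_false (by linarith [hpos h]) (by omega)
  · exact iff_of_false (hpos h).not_gt (by omega)
  · exact iff_of_false (lt_irrefl _) (by omega)
  · exact iff_of_true (by norm_num) (by omega)

lemma chamberLevel_succ_lt_succ (hu : Monotone u) (hu0 : ∀ i, 0 ≤ u i) (hK : zeroCount u ≤ K)
    {p q : Fin n} : chamberLevel u K τ p.succ < chamberLevel u K τ q.succ ↔
      truncate u K (τ p) < truncate u K (τ q) := by
  have hpos : ∀ p, K ≤ τ p → 0 < u (τ p) := fun p h => (zeroCount_le_iff hu hu0).1 (hK.trans h)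
  simp only [chamberLevel, truncate, Fin.cons_succ]
  split_ifs with h h' h'
  · rfl
  · exact iff_of_false (by linarith [hpos p h]) (hpos p h).not_gt
  · exact iff_of_true (by linarith [hpos q h']) (hpos q h')
  · simp

lemma truncate_nonneg (hu0 : ∀ i, 0 ≤ u i) (K : ℕ) (i : Fin n) : 0 ≤ truncate u K i := by
  unfold truncate
  split_ifs
  exacts [hu0 i, le_rfl]

lemma truncate_le (hu0 : ∀ i, 0 ≤ u i) (K : ℕ) (i : Fin n) : truncate u K i ≤ u i := by
  unfold truncate
  split_ifs
  exacts [le_rfl, hu0 i]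

lemma truncate_monotone (hu : Monotone u) (hu0 : ∀ i, 0 ≤ u i) (K : ℕ) :
    Monotone (truncate u K) := by
  intro i j hij
  unfold truncate
  split_ifs with hi hj
  exacts [hu hij, absurd (hi.trans hij) hj, hu0 j, le_rfl]

lemma mem_slicedCone_chamberLevel_iff (hu : Monotone u) (hu0 : ∀ i, 0 ≤ u i)
    (hK : zeroCount u ≤ K) {w : Fin n → ℝ} :
    w ∈ slicedCone (levelOrder (chamberLevel u K τ)) ↔
      (∀ p q, truncate u K (τ p) < truncate u K (τ q) → w p ≤ w q) ∧
      (∀ q, K ≤ τ q → 0 ≤ w q) ∧ (∀ p, (τ p : ℕ) < K → zeroCount u < K → w p ≤ 0) := by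
  have hiff : w ∈ slicedCone (levelOrder (chamberLevel u K τ)) ↔
      ∀ i j, chamberLevel u K τ i < chamberLevel u K τ j → consZero w i ≤ consZero w j := by
    refine forall₂_congr fun i j => ⟨fun h hij => h (.inr hij), ?_⟩
    rintro h (rfl | hij)
    exacts [le_rfl, h hij]
  rw [hiff]
  simp only [Fin.forall_fin_succ, chamberLevel_zero_lt_succ hu hu0 hK,
    chamberLevel_succ_lt_zero hu hu0 hK, chamberLevel_succ_lt_succ hu hu0 hK, consZero_zero,
    consZero_succ, le_refl, implies_true, true_and, and_imp, forall_and]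
  tauto

lemma dotProduct_le_truncate (hu : Monotone u) (hu0 : ∀ i, 0 ≤ u i) (hK : zeroCount u ≤ K)
    {w y : Fin n → ℝ} (hw : w ∈ slicedCone (levelOrder (chamberLevel u K τ))) (hy : y ∈ PF u) :
    w ⬝ᵥ y ≤ w ⬝ᵥ (truncate u K ∘ τ) := by
  obtain ⟨hlt, hge, hle⟩ := (mem_slicedCone_chamberLevel_iff hu hu0 hK).1 hw
  have hmono : Monovary (w ⊔ 0) (u ∘ τ) := by
    intro p q hpq
    by_cases hq : K ≤ τ q
    · exact sup_le_sup_right (hlt p q ((truncate_le hu0 K _).trans_lt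
        (by simpa [truncate, hq] using hpq))) 0
    · have hmK := ((zeroCount_le_iff hu hu0).2 ((hu0 _).trans_lt hpq)).trans_lt (not_le.1 hq)
      have hpK := (Fin.lt_def.1 (hu.reflect_lt hpq)).trans (not_le.1 hq)
      exact sup_le ((hle p hpK hmK).trans le_sup_right) le_sup_right
  convert dotProduct_le_of_mem_PF hu hmono hy using 1
  refine Finset.sum_congr rfl fun p _ => ?_
  simp only [Function.comp_apply, truncate, Pi.sup_apply, Pi.zero_apply]
  split_ifs with hp
  · rw [sup_of_le_left (hge p hp)]
  rcases (hu0 (τ p)).eq_or_lt with h0 | hpos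
  · rw [← h0, mul_zero, mul_zero]
  · rw [sup_of_le_right (hle p (not_le.1 hp) (((zeroCount_le_iff hu hu0).2 hpos).trans_lt
      (not_le.1 hp))), mul_zero, zero_mul]

lemma truncate_comp_mem_PF (hu : Monotone u) (hu0 : ∀ i, 0 ≤ u i) (K : ℕ)
    (τ : Equiv.Perm (Fin n)) : truncate u K ∘ τ ∈ PF u :=
  mem_PF_of_le_perm hu (fun _ => truncate_nonneg hu0 K _) τ fun _ => truncate_le hu0 K _

lemma truncate_comp_sub_mem_PF (hu : Monotone u) (hu0 : ∀ i, 0 ≤ u i) (K : ℕ)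
    (τ : Equiv.Perm (Fin n)) (q : Fin n) :
    truncate u K ∘ τ - truncate u K (τ q) • edgeVector q.succ ∈ PF u := by
  have hcoord : ∀ x, (truncate u K ∘ τ - truncate u K (τ q) • edgeVector q.succ) x =
      if x = q then 0 else truncate u K (τ x) := by
    intro x
    by_cases hx : x = q <;> simp [hx]
  refine mem_PF_of_le_perm hu (fun x => ?_) τ fun x => ?_ <;> rw [hcoord] <;> split_ifs
  exacts [le_rfl, truncate_nonneg hu0 K _, hu0 _, truncate_le hu0 K _]

lemma truncate_comp_add_mem_PF (hu : Monotone u) (hu0 : ∀ i, 0 ≤ u i) {p k : Fin n}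
    (hk : (k : ℕ) < K) (hp : (τ p : ℕ) < K) :
    truncate u K ∘ τ + u k • edgeVector p.succ ∈ PF u := by
  have hcoord : ∀ x, (truncate u K ∘ τ + u k • edgeVector p.succ) x =
      if x = p then u k else truncate u K (τ x) := by
    intro x
    by_cases hx : x = p <;> simp [hx, truncate, hp.not_ge]
  refine mem_PF_of_le_perm hu (fun x => ?_) (τ.trans (Equiv.swap (τ p) k)) fun x => ?_ <;>
    rw [hcoord] <;> split_ifs with hx
  · exact hu0 k
  · exact truncate_nonneg hu0 K _
  · simp [hx]
  · unfold truncate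
    split_ifs with hxK
    · rw [Equiv.trans_apply, Equiv.swap_apply_of_ne_of_ne (τ.injective.ne hx)]
      rintro rfl
      exact hxK.not_gt hk
    · exact hu0 _

lemma truncate_comp_add_sub_mem_PF (hu : Monotone u) (hu0 : ∀ i, 0 ≤ u i) (K : ℕ)
    (τ : Equiv.Perm (Fin n)) (p q : Fin n) :
    truncate u K ∘ τ + (truncate u K (τ q) - truncate u K (τ p)) •
      (edgeVector p.succ - edgeVector q.succ) ∈ PF u := by
  convert truncate_comp_mem_PF hu hu0 K ((Equiv.swap p q).trans τ) using 1
  ext x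
  rcases eq_or_ne p q with rfl | hpq
  · simp
  rcases eq_or_ne x p with rfl | hp
  · simp [hpq]
  rcases eq_or_ne x q with rfl | hq
  · simp [hpq.symm]
  · simp [hp, hq, Equiv.swap_apply_of_ne_of_ne]

theorem isVertexPreorder_PF (hu : Monotone u) (hu0 : ∀ i, 0 ≤ u i) (hK : zeroCount u ≤ K)
    (hKn : K ≤ n) (τ : Equiv.Perm (Fin n)) :
    IsVertexPreorder (PF u) (truncate u K ∘ τ) (levelOrder (chamberLevel u K τ)) := by
  refine ⟨inferInstance, truncate_comp_mem_PF hu hu0 K τ,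
    fun w hw y hy => dotProduct_le_truncate hu hu0 hK hw hy, fun i j hij => ?_⟩
  rcases hij with rfl | hij
  · exact ⟨1, one_pos, by simpa using truncate_comp_mem_PF hu hu0 K τ⟩
  cases i using Fin.cases with
  | zero =>
    cases j using Fin.cases with
    | zero => exact absurd hij (lt_irrefl _)
    | succ q =>
      rw [chamberLevel_zero_lt_succ hu hu0 hK] at hij
      refine ⟨truncate u K (τ q), ?_, ?_⟩
      · simpa [truncate, hij] using (zeroCount_le_iff hu hu0).1 (hK.trans hij)
      · simpa [sub_eq_add_neg] using truncate_comp_sub_mem_PF hu hu0 K τ q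
  | succ p =>
    cases j using Fin.cases with
    | zero =>
      obtain ⟨hp, hmK⟩ := (chamberLevel_succ_lt_zero hu hu0 hK).1 hij
      refine ⟨u ⟨K - 1, by omega⟩, (zeroCount_le_iff hu hu0).1 (Nat.le_sub_one_of_lt hmK), ?_⟩
      simpa using truncate_comp_add_mem_PF hu hu0 (k := ⟨K - 1, by omega⟩)
        (Nat.sub_one_lt_of_lt hmK) hp
    | succ q =>
      rw [chamberLevel_succ_lt_succ hu hu0 hK] at hij
      exact ⟨_, sub_pos.2 hij, truncate_comp_add_sub_mem_PF hu hu0 K τ p q⟩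

lemma zeroCount_le (u : Fin n → ℝ) : zeroCount u ≤ n := by
  simpa [zeroCount] using Finset.card_filter_le Finset.univ fun i => u i = 0

theorem exists_mem_slicedCone_chamberLevel (hu : Monotone u) (hu0 : ∀ i, 0 ≤ u i)
    (w : Fin n → ℝ) : ∃ K τ, zeroCount u ≤ K ∧ K ≤ n ∧
      w ∈ slicedCone (levelOrder (chamberLevel u K τ)) := by
  have hsort := Tuple.monotone_sort w
  obtain ⟨k, hk, hwk⟩ := exists_forall_iff_val_lt (p := fun i => (w ∘ Tuple.sort w) i ≤ 0)
    fun i j hij hj => (hsort hij).trans hj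
  set τ := (Tuple.sort w)⁻¹
  have hwk' : ∀ p, w p ≤ 0 ↔ (τ p : ℕ) < k := fun p => by simpa [τ] using hwk (τ p)
  refine ⟨max (zeroCount u) k, τ, le_max_left _ _, max_le (zeroCount_le u) hk,
    (mem_slicedCone_chamberLevel_iff hu hu0 (le_max_left _ _)).2
      ⟨fun p q hpq => ?_, fun q hq => ?_, fun p hp hm => ?_⟩⟩
  · simpa [τ] using hsort ((truncate_monotone hu hu0 _).reflect_lt hpq).le
  · by_contra! hwq
    exact ((hwk' q).1 hwq.le).not_ge ((le_max_right _ _).trans hq)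
  · have hmk : zeroCount u < k := (lt_max_iff.1 hm).resolve_left (lt_irrefl _)
    rw [max_eq_right hmk.le] at hp
    exact (hwk' p).2 hp

/-- The preorders describing `PF(u)` near its vertices. -/
def chamberOrders (u : Fin n → ℝ) : Set (Fin (n + 1) → Fin (n + 1) → Prop) :=
  {r | ∃ K τ, zeroCount u ≤ K ∧ K ≤ n ∧ r = levelOrder (chamberLevel u K τ)}

theorem isVertexFamily_PF (hu : Monotone u) (hu0 : ∀ i, 0 ≤ u i) :
    IsVertexFamily (PF u) (chamberOrders u) where
  exists_vertex := by
    rintro _ ⟨K, τ, hK, hKn, rfl⟩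
    exact ⟨_, isVertexPreorder_PF hu hu0 hK hKn τ⟩
  exists_mem_slicedCone w := by
    obtain ⟨K, τ, hK, hKn, hw⟩ := exists_mem_slicedCone_chamberLevel hu hu0 w
    exact ⟨_, ⟨K, τ, hK, hKn, rfl⟩, hw⟩

end Chamber

/-! ### Types of skewed binary partitions -/

lemma exists_perm_of_card_fiber_eq {α β : Type*} [Fintype α] [DecidableEq β] {f g : α → β}
    (h : ∀ b, (Finset.univ.filter fun a => f a = b).card =
      (Finset.univ.filter fun a => g a = b).card) :
    ∃ σ : Equiv.Perm α, ∀ a, g (σ a) = f a :=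
  ⟨Equiv.ofFiberEquiv fun b => Fintype.equivOfCardEq (by simpa [Fintype.card_subtype] using h b),
    Equiv.ofFiberEquiv_map _⟩

namespace SkewedBinaryPartition

variable {n : ℕ} {A B : SkewedBinaryPartition n}

lemma zero_mem_block_one_iff_of_type_eq (h : A.type = B.type) :
    0 ∈ A.block 1 ↔ 0 ∈ B.block 1 := by
  have := congrArg (·[1]?) h
  by_cases hA : 0 ∈ A.block 1 <;> by_cases hB : 0 ∈ B.block 1 <;> simp_all [type]

lemma card_block_zero_eq_of_type_eq (h : A.type = B.type) :
    (A.block 0).card = (B.block 0).card := by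
  have h0 := congrArg (·[0]?) h
  have hzero := zero_mem_block_one_iff_of_type_eq h
  by_cases hA : 0 ∈ A.block 1
  · simpa [type, hA, hzero.1 hA] using h0
  · have hB := mt hzero.2 hA
    have hA0 := (A.of_zero_mem_first (A.zero_mem.resolve_right hA)).1
    have hB0 := (B.of_zero_mem_first (B.zero_mem.resolve_right hB)).1
    have : (A.block 0).card - 1 = (B.block 0).card - 1 := by simpa [type, hA, hB] using h0
    omega

lemma card_block_one_eq_of_type_eq (h : A.type = B.type) :
    (A.block 1).card = (B.block 1).card := by
  have h1 := congrArg (·[1]?) h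
  have hzero := zero_mem_block_one_iff_of_type_eq h
  by_cases hA : 0 ∈ A.block 1
  · have hB := hzero.1 hA
    have hA1 := Finset.card_pos.2 ⟨0, hA⟩
    have hB1 := Finset.card_pos.2 ⟨0, hB⟩
    have : (A.block 1).card - 1 = (B.block 1).card - 1 := by simpa [type, hA, hB] using h1
    omega
  · rw [(A.of_zero_mem_first (A.zero_mem.resolve_right hA)).2,
      (B.of_zero_mem_first (B.zero_mem.resolve_right (mt hzero.2 hA))).2]

lemma k_eq_of_type_eq (h : A.type = B.type) : A.k = B.k := by
  have hlen : ∀ C : SkewedBinaryPartition n, C.type.length = C.k + 2 := by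
    intro C
    unfold type
    split_ifs <;> rw [List.length_append, List.length_ofFn, add_comm] <;> rfl
  have := congrArg List.length h
  rw [hlen, hlen] at this
  omega

lemma getElem?_type_add_two (C : SkewedBinaryPartition n) {i : ℕ} (hi : i < C.k) :
    C.type[i + 2]? = some (if C.homog (Fin.succ (Fin.succ ⟨i, hi⟩)) = true
      then Entry.star (C.block (Fin.succ (Fin.succ ⟨i, hi⟩))).card
      else Entry.plain (C.block (Fin.succ (Fin.succ ⟨i, hi⟩))).card) := by
  by_cases h0 : 0 ∈ C.block 1 <;> simp [type, h0, hi]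

lemma card_homog_eq_of_type_eq (h : A.type = B.type) {i : Fin (A.k + 2)} {j : Fin (B.k + 2)}
    (hij : (i : ℕ) = j) : (A.block i).card = (B.block j).card ∧ A.homog i = B.homog j := by
  cases i using Fin.cases with
  | zero =>
    obtain rfl : j = 0 := Fin.ext hij.symm
    exact ⟨card_block_zero_eq_of_type_eq h, A.homog_first.trans B.homog_first.symm⟩
  | succ i =>
    cases j using Fin.cases with
    | zero => simp at hij
    | succ j =>
      cases i using Fin.cases with
      | zero =>
        obtain rfl : j = 0 := Fin.ext (by simpa using hij.symm)
        have hcard := card_block_one_eq_of_type_eq h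
        refine ⟨hcard, Bool.eq_iff_iff.2 ⟨fun hA => ?_, fun hB => ?_⟩⟩
        · exact B.homog_second (hcard ▸ A.two_le_of_homog _ hA)
        · exact A.homog_second (hcard ▸ B.two_le_of_homog _ hB)
      | succ i =>
        cases j using Fin.cases with
        | zero => simp at hij
        | succ j =>
          have hij : (i : ℕ) = j := by simpa using hij
          have hjk : (i : ℕ) < B.k := hij ▸ j.2
          obtain rfl : j = ⟨i, hjk⟩ := Fin.ext hij.symm
          have hi := A.getElem?_type_add_two i.2
          rw [h, B.getElem?_type_add_two hjk, Option.some_inj] at hi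
          split_ifs at hi with hB hA hA
          · exact ⟨(Entry.star.inj hi).symm, hA.trans hB.symm⟩
          · exact ⟨(Entry.plain.inj hi).symm, by rw [Bool.eq_iff_iff]; exact iff_of_false hA hB⟩

lemma exists_perm_idx_eq_of_type_eq (h : A.type = B.type) :
    ∃ σ : Equiv.Perm (Fin (n + 1)), ∀ p, (B.idx (σ p) : ℕ) = A.idx p := by
  have hcard : ∀ (C : SkewedBinaryPartition n) (i : Fin (C.k + 2)),
      (Finset.univ.filter fun p => (C.idx p : ℕ) = i) = C.block i := by
    intro C i
    ext p
    rw [mem_block_iff, Finset.mem_filter_univ, Fin.ext_iff]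
  have hempty : ∀ (C : SkewedBinaryPartition n) (i : ℕ), ¬ i < C.k + 2 →
      (Finset.univ.filter fun p => (C.idx p : ℕ) = i) = ∅ := fun C i hi =>
    Finset.filter_eq_empty_iff.2 fun p _ hp => hi (hp ▸ (C.idx p).2)
  have hk := k_eq_of_type_eq h
  refine exists_perm_of_card_fiber_eq (f := fun p => (A.idx p : ℕ)) (g := fun p => (B.idx p : ℕ))
    fun i => ?_
  by_cases hi : i < A.k + 2
  · rw [hcard A ⟨i, hi⟩, hcard B ⟨i, hk ▸ hi⟩]
    exact (card_homog_eq_of_type_eq h rfl).1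
  · rw [hempty A i hi, hempty B i (hk ▸ hi)]

lemma val_idx_zero_eq_of_type_eq (h : A.type = B.type) : (A.idx 0 : ℕ) = B.idx 0 := by
  have hzero := zero_mem_block_one_iff_of_type_eq h
  simp only [mem_block_iff] at hzero
  rcases A.idx_zero with hA | hA
  · rw [hA, B.idx_zero.resolve_right fun hB => by simp [hzero.2 hB] at hA]
    rfl
  · rw [hA, hzero.1 hA]
    rfl

theorem exists_perm_of_type_eq (h : A.type = B.type) : ∃ τ : Equiv.Perm (Fin n), ∀ p q,
    A.rel p q ↔ B.rel (Equiv.Perm.decomposeFin.symm (0, τ) p)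
      (Equiv.Perm.decomposeFin.symm (0, τ) q) := by
  obtain ⟨σ, hσ⟩ := exists_perm_idx_eq_of_type_eq h
  obtain ⟨⟨c, τ⟩, rfl⟩ := Equiv.Perm.decomposeFin.symm.surjective σ
  have hc : B.idx c = B.idx 0 := Fin.ext <| by
    simpa [val_idx_zero_eq_of_type_eq h] using hσ 0
  have hτ : ∀ p, (A.idx p : ℕ) = B.idx (Equiv.Perm.decomposeFin.symm (0, τ) p) := by
    intro p
    rw [← hσ]
    cases p using Fin.cases with
    | zero => simp [hc]
    | succ p =>
      simp only [Equiv.Perm.decomposeFin_symm_apply_succ, Equiv.swap_self, Equiv.refl_apply,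
        Equiv.swap_apply_def]
      split_ifs with h0 hpc
      · exact absurd h0 (Fin.succ_ne_zero _)
      · rw [hpc, hc]
      · rfl
  refine ⟨τ, fun p q => ?_⟩
  rw [rel_iff, rel_iff, Fin.lt_def, Fin.lt_def, Fin.ext_iff (a := A.idx _),
    Fin.ext_iff (a := B.idx _), hτ, hτ, (card_homog_eq_of_type_eq h (hτ p)).2,
    EmbeddingLike.apply_eq_iff_eq]

end SkewedBinaryPartition

/-! ### The types in `Ω_m` -/

/-- Lowers the sum of the list by `i`, taking as much as possible from the front and deleting the
entries that are used up. This is how the entries of `𝐚_i` after the first two arise from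
`(m_1, …, m_ℓ)`. -/
def dropMass : ℕ → List ℕ → List ℕ
  | _, [] => []
  | i, m :: ms => if i < m then (m - i) :: ms else dropMass (i - m) ms

lemma dropMass_zero : ∀ {ms : List ℕ}, (∀ m ∈ ms, 0 < m) → dropMass 0 ms = ms
  | [], _ => rfl
  | m :: ms, h => by simp [dropMass, h m]

lemma dropMass_sum (ms : List ℕ) : dropMass ms.sum ms = [] := by
  induction ms with
  | nil => rfl
  | cons m ms ih => simpa [dropMass] using ih

lemma dropMass_eq {ms : List ℕ} {i g : ℕ} (h : (ms.take g).sum ≤ i)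
    (h' : i < (ms.take (g + 1)).sum) :
    dropMass i ms = ((ms.take (g + 1)).sum - i) :: ms.drop (g + 1) := by
  induction g generalizing ms i with
  | zero =>
    cases ms with
    | nil => simp at h'
    | cons m ms => simp_all [dropMass]
  | succ g ih =>
    cases ms with
    | nil => simp at h'
    | cons m ms =>
      rw [List.take_succ_cons, List.sum_cons] at h h' ⊢
      rw [dropMass, if_neg (by omega), ih (by omega) (by omega), Nat.sub_sub_right _ (by omega),
        add_comm m, List.drop_succ_cons]

lemma dropMass_append_cons {l₁ l₂ : List ℕ} {m i : ℕ} (h : l₁.sum ≤ i) (h' : i < l₁.sum + m) :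
    dropMass i (l₁ ++ m :: l₂) = (l₁.sum + m - i) :: l₂ := by
  rw [dropMass_eq (g := l₁.length)] <;> simp [*]

lemma exists_sum_take_le_lt {ms : List ℕ} {i : ℕ} (h : i < ms.sum) :
    ∃ g, (ms.take g).sum ≤ i ∧ i < (ms.take (g + 1)).sum := by
  induction ms generalizing i with
  | nil => simp at h
  | cons m ms ih =>
    by_cases him : i < m
    · exact ⟨0, by simp, by simpa⟩
    · rw [List.sum_cons] at h
      obtain ⟨g, hg, hg'⟩ := ih (i := i - m) (by omega)
      exact ⟨g + 1, by rw [List.take_succ_cons, List.sum_cons]; omega,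
        by rw [List.take_succ_cons, List.sum_cons]; omega⟩

/-- The first two entries of `𝐚_i`, in terms of `m_0` and `K = m_0 + i`. -/
def omegaHead (m₀ K : ℕ) : List Entry :=
  if K = m₀ ∧ 0 < K then [.plain K, .plain 0] else [.plain K, .circ 0]

lemma mem_Omega_cons_iff {m₀ : ℕ} {ms : List ℕ} (hne : ms ≠ []) (hpos : ∀ m ∈ ms, 0 < m)
    {b : List Entry} : b ∈ Omega (m₀ :: ms) ↔
      ∃ i ≤ ms.sum, b = omegaHead m₀ (m₀ + i) ++ (dropMass i ms).map .plain := by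
  have hsum : 0 < ms.sum := List.sum_pos _ hpos hne
  have hfirst : omegaZero m₀ ms = omegaHead m₀ (m₀ + 0) ++ (dropMass 0 ms).map .plain := by
    rw [dropMass_zero hpos, omegaZero, omegaHead]
    rcases m₀.eq_zero_or_pos with rfl | h <;> simp [*]
  have hhead : ∀ {i}, 1 ≤ i → omegaHead m₀ (m₀ + i) = [.plain (m₀ + i), .circ 0] := fun hi =>
    if_neg (by omega)
  have hlast : [Entry.plain (m₀ + ms.sum), .circ 0] =
      omegaHead m₀ (m₀ + ms.sum) ++ (dropMass ms.sum ms).map .plain := by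
    rw [hhead hsum, dropMass_sum, List.map_nil, List.append_nil]
  simp only [Omega, Set.mem_union, Set.mem_singleton_iff, Set.mem_ofPred_eq]
  constructor
  · rintro ((rfl | ⟨i, _ | g, hi, hg, h, h', rfl⟩) | rfl)
    · exact ⟨0, Nat.zero_le _, hfirst⟩
    · exact absurd hg (by simp)
    · refine ⟨i, h'.le.trans ((List.take_sublist _ _).sum_le_sum fun _ _ => Nat.zero_le _), ?_⟩
      rw [hhead hi, dropMass_eq h h']
      simp
    · exact ⟨_, le_rfl, hlast⟩
  · rintro ⟨i, hi, rfl⟩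
    rcases i.eq_zero_or_pos with rfl | hi0
    · exact .inl (.inl hfirst.symm)
    rcases hi.eq_or_lt with rfl | hi
    · exact .inr hlast.symm
    · obtain ⟨g, hg, hg'⟩ := exists_sum_take_le_lt hi
      refine .inl (.inr ⟨i, g + 1, hi0, by simp, hg, hg', ?_⟩)
      rw [hhead hi0, dropMass_eq hg hg']
      simp

section Multiplicity

variable {n n' : ℕ} {u f : Fin n → ℝ} {K : ℕ}

/-- The multiplicities `(m_1, …, m_ℓ)` of the positive values of `f`. -/
noncomputable def positiveMultiplicities (f : Fin n → ℝ) : List ℕ :=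
  (dataVector f).map fun x => (levelBlock f x).card

lemma multiplicityVector_eq (u : Fin n → ℝ) :
    multiplicityVector u = zeroCount u :: positiveMultiplicities u := rfl

lemma sum_card_levelBlock {l : List ℝ} (hl : l.Nodup) (f : Fin n → ℝ) :
    (l.map fun x => (levelBlock f x).card).sum =
      (Finset.univ.filter fun i => f i ∈ l).card := by
  rw [← List.sum_toFinset _ hl]
  simp only [levelBlock]
  rw [Finset.sum_card_fiberwise_eq_card_filter]
  simp only [List.mem_toFinset]

lemma nodup_zero_cons_dataVector (f : Fin n → ℝ) : (0 :: dataVector f).Nodup :=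
  List.nodup_cons.2 ⟨fun h => (mem_dataVector.1 h).1.false, (sortedLT_dataVector f).nodup⟩

lemma sum_multiplicityVector (hu0 : ∀ i, 0 ≤ u i) : (multiplicityVector u).sum = n := by
  have hmem : ∀ i, u i ∈ 0 :: dataVector u := fun i => List.mem_cons.2 <|
    (hu0 i).eq_or_lt.imp Eq.symm fun h => mem_dataVector.2 ⟨h, i, rfl⟩
  calc (multiplicityVector u).sum
      = (Finset.univ.filter fun i => u i ∈ 0 :: dataVector u).card :=
        sum_card_levelBlock (nodup_zero_cons_dataVector u) u
    _ = n := by simp only [hmem, Finset.filter_true, Finset.card_univ, Fintype.card_fin]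

lemma card_levelBlock_pos {x : ℝ} : 0 < (levelBlock f x).card ↔ ∃ i, f i = x := by
  simp only [Finset.card_pos, Finset.Nonempty, mem_levelBlock]

lemma pos_of_mem_positiveMultiplicities {m : ℕ} (hm : m ∈ positiveMultiplicities f) : 0 < m := by
  obtain ⟨x, hx, rfl⟩ := List.mem_map.1 hm
  exact card_levelBlock_pos.2 (mem_dataVector.1 hx).2

lemma positiveMultiplicities_ne_nil (hu0 : ∀ i, 0 ≤ u i) (hne : u ≠ 0) :
    positiveMultiplicities u ≠ [] := by
  obtain ⟨i, hi⟩ := Function.ne_iff.1 hne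
  rw [positiveMultiplicities, Ne, List.map_eq_nil_iff]
  exact List.ne_nil_of_mem (mem_dataVector.2 ⟨(hu0 i).lt_of_ne' hi, i, rfl⟩)

lemma dataVector_eq_of_sortedLT {l : List ℝ} (hl : l.SortedLT)
    (h : ∀ x, x ∈ l ↔ 0 < x ∧ ∃ i, f i = x) : dataVector f = l :=
  (sortedLT_dataVector f).eq_of_mem_iff hl fun x => mem_dataVector.trans (h x).symm

lemma positiveMultiplicities_congr {f' : Fin n' → ℝ}
    (h : ∀ x, 0 < x → (levelBlock f x).card = (levelBlock f' x).card) :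
    positiveMultiplicities f = positiveMultiplicities f' := by
  have hdata : dataVector f = dataVector f' :=
    dataVector_eq_of_sortedLT (sortedLT_dataVector f') fun x =>
      mem_dataVector.trans <| and_congr_right fun hx => by
        rw [← card_levelBlock_pos, ← card_levelBlock_pos, h x hx]
  rw [positiveMultiplicities, positiveMultiplicities, hdata]
  exact List.map_congr_left fun x hx => h x (mem_dataVector.1 hx).1

lemma truncate_of_le (hK : n ≤ K) (i : Fin n) : truncate u K i = 0 :=
  if_neg (by omega)

lemma zeroCount_add_sum_eq_card_lt (hu0 : ∀ i, 0 ≤ u i) {t : ℝ} {l₁ l₂ : List ℝ} (ht : 0 < t)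
    (h : dataVector u = l₁ ++ t :: l₂) :
    zeroCount u + (l₁.map fun x => (levelBlock u x).card).sum =
      (Finset.univ.filter fun i => u i < t).card := by
  have hsorted := h ▸ (sortedLT_dataVector u).pairwise
  obtain ⟨-, h₂, h₁⟩ := List.pairwise_append.1 hsorted
  have hnodup : (0 :: l₁).Nodup := (h ▸ nodup_zero_cons_dataVector u).sublist
    (List.cons_sublist_cons.2 (List.sublist_append_left _ _))
  refine (sum_card_levelBlock hnodup u).trans (congrArg _ (Finset.filter_congr fun i _ => ?_))
  rw [List.mem_cons]
  constructor
  · rintro (hi | hi)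
    · exact hi ▸ ht
    · exact h₁ _ hi t List.mem_cons_self
  · refine fun hi => (hu0 i).eq_or_lt.imp Eq.symm fun hpos => ?_
    have hmem : u i ∈ l₁ ++ t :: l₂ := h ▸ mem_dataVector.2 ⟨hpos, i, rfl⟩
    refine (List.mem_append.1 hmem).resolve_right fun hi' => ?_
    rcases List.mem_cons.1 hi' with hi' | hi'
    · exact hi.ne hi'
    · exact hi.not_gt ((List.pairwise_cons.1 h₂).1 _ hi')

lemma dataVector_truncate (hu : Monotone u) {k : Fin n} {l₁ l₂ : List ℝ}
    (h : dataVector u = l₁ ++ u k :: l₂) : dataVector (truncate u k) = u k :: l₂ := by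
  have hsorted := h ▸ (sortedLT_dataVector u).pairwise
  obtain ⟨-, h₂, h₁⟩ := List.pairwise_append.1 hsorted
  refine dataVector_eq_of_sortedLT h₂.sortedLT fun x => ?_
  have hx : x ∈ l₁ ++ u k :: l₂ ↔ 0 < x ∧ ∃ i, u i = x := h ▸ mem_dataVector
  constructor
  · intro hmem
    obtain ⟨hpos, i, rfl⟩ := hx.1 (List.mem_append_right _ hmem)
    rcases List.mem_cons.1 hmem with hi | hi
    · exact ⟨hpos, k, by simp [truncate, hi]⟩
    · have hki : k ≤ i := (hu.reflect_lt ((List.pairwise_cons.1 h₂).1 _ hi)).le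
      exact ⟨hpos, i, if_pos hki⟩
  · rintro ⟨hpos, i, rfl⟩
    have hki : k ≤ i := by
      by_contra hki
      rw [truncate, if_neg (mt Fin.le_def.2 hki)] at hpos
      exact hpos.false
    rw [truncate, if_pos (Fin.le_def.1 hki)] at hpos hx ⊢
    refine (List.mem_append.1 (hx.2 ⟨hpos, i, rfl⟩)).resolve_left fun hi => ?_
    exact (h₁ _ hi _ List.mem_cons_self).not_ge (hu hki)

lemma card_levelBlock_truncate_self (hu : Monotone u) {k : Fin n} (hk : 0 < u k) :
    k + (levelBlock (truncate u k) (u k)).card =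
      (Finset.univ.filter fun i => u i < u k).card + (levelBlock u (u k)).card := by
  have hval : ∀ i, truncate u k i = u k ↔ k ≤ i ∧ u i = u k := by
    intro i
    rw [truncate, Fin.le_def]
    split_ifs with hki <;> simp [hki, hk.ne]
  calc (k : ℕ) + (levelBlock (truncate u k) (u k)).card
      = (Finset.Iio k ∪ levelBlock (truncate u k) (u k)).card := by
        rw [Finset.card_union_of_disjoint, Fin.card_Iio]
        refine Finset.disjoint_left.2 fun i hi hi' => ?_
        exact (Finset.mem_Iio.1 hi).not_ge ((hval i).1 (mem_levelBlock.1 hi')).1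
    _ = (Finset.univ.filter fun i => u i ≤ u k).card := by
        congr 1
        ext i
        rw [Finset.mem_union, Finset.mem_Iio, mem_levelBlock, hval, Finset.mem_filter_univ]
        constructor
        · rintro (hi | hi)
          exacts [hu hi.le, hi.2.le]
        · exact fun hi => (lt_or_ge i k).imp_right fun hki => ⟨hki, hi.antisymm (hu hki)⟩
    _ = (Finset.univ.filter fun i => u i < u k).card + (levelBlock u (u k)).card := by
        rw [levelBlock, ← Finset.card_union_of_disjoint, ← Finset.filter_or]
        · simp only [le_iff_lt_or_eq]
        · exact Finset.disjoint_filter.2 fun i _ hi => hi.ne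

lemma positiveMultiplicities_truncate_of_le (hu0 : ∀ i, 0 ≤ u i) (hK : n ≤ K) :
    positiveMultiplicities (truncate u K) =
      dropMass (n - zeroCount u) (positiveMultiplicities u) := by
  have hsum := sum_multiplicityVector hu0
  rw [multiplicityVector_eq, List.sum_cons] at hsum
  have hdata : dataVector (truncate u K) = [] := List.eq_nil_iff_forall_not_mem.2 fun x hx => by
    obtain ⟨hpos, i, rfl⟩ := mem_dataVector.1 hx
    exact hpos.ne' (truncate_of_le hK i)
  rw [Nat.sub_eq_of_eq_add' hsum.symm, dropMass_sum, positiveMultiplicities, hdata, List.map_nil]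

theorem positiveMultiplicities_truncate (hu : Monotone u) (hu0 : ∀ i, 0 ≤ u i)
    {k : Fin n} (hk : zeroCount u ≤ k) :
    positiveMultiplicities (truncate u k) =
      dropMass (k - zeroCount u) (positiveMultiplicities u) := by
  have hpos := (zeroCount_le_iff hu hu0).1 hk
  obtain ⟨l₁, l₂, h⟩ := List.append_of_mem (mem_dataVector.2 ⟨hpos, k, rfl⟩)
  have hlt := zeroCount_add_sum_eq_card_lt hu0 hpos h
  have hself := card_levelBlock_truncate_self hu hpos
  have hlek : (Finset.univ.filter fun i => u i < u k).card ≤ k := by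
    rw [← Fin.card_Iio]
    exact Finset.card_le_card fun i hi =>
      Finset.mem_Iio.2 (hu.reflect_lt (Finset.mem_filter_univ i |>.1 hi))
  have hcard : 0 < (levelBlock (truncate u k) (u k)).card :=
    card_levelBlock_pos.2 ⟨k, if_pos le_rfl⟩
  have htail : ∀ x ∈ l₂, (levelBlock (truncate u k) x).card = (levelBlock u x).card := by
    intro x hx
    have hkx : u k < x := by
      have hsorted := h ▸ (sortedLT_dataVector u).pairwise
      exact (List.pairwise_cons.1 (List.pairwise_append.1 hsorted).2.1).1 x hx
    congr 1
    ext i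
    rw [mem_levelBlock, mem_levelBlock, truncate]
    split_ifs with hi
    · rfl
    · have hik : u i ≤ u k := hu (Fin.le_def.2 (not_le.1 hi).le)
      exact iff_of_false (hpos.trans hkx).ne (hik.trans_lt hkx).ne
  rw [positiveMultiplicities, dataVector_truncate hu h, positiveMultiplicities, h, List.map_append,
    List.map_cons, List.map_cons, dropMass_append_cons (by omega) (by omega),
    List.map_congr_left htail]
  congr 1
  omega

lemma mem_Omega_multiplicityVector_iff (hu : Monotone u) (hu0 : ∀ i, 0 ≤ u i) (hne : u ≠ 0)
    {b : List Entry} : b ∈ Omega (multiplicityVector u) ↔ ∃ K, zeroCount u ≤ K ∧ K ≤ n ∧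
      b = omegaHead (zeroCount u) K ++ (positiveMultiplicities (truncate u K)).map .plain := by
  have hsum := sum_multiplicityVector hu0
  rw [multiplicityVector_eq, List.sum_cons] at hsum
  have htruncate : ∀ K, zeroCount u ≤ K → K ≤ n → positiveMultiplicities (truncate u K) =
      dropMass (K - zeroCount u) (positiveMultiplicities u) := by
    intro K hK hKn
    rcases hKn.eq_or_lt with rfl | hKn
    · exact positiveMultiplicities_truncate_of_le hu0 le_rfl
    · exact positiveMultiplicities_truncate hu hu0 (k := ⟨K, hKn⟩) hK
  rw [multiplicityVector_eq, mem_Omega_cons_iff (positiveMultiplicities_ne_nil hu0 hne)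
    fun _ => pos_of_mem_positiveMultiplicities]
  constructor
  · rintro ⟨i, hi, rfl⟩
    refine ⟨zeroCount u + i, by omega, by omega, ?_⟩
    rw [htruncate _ (by omega) (by omega), Nat.add_sub_cancel_left]
  · rintro ⟨K, hK, hKn, rfl⟩
    refine ⟨K - zeroCount u, by omega, ?_⟩
    rw [htruncate K hK hKn, Nat.add_sub_cancel' hK]

end Multiplicity

/-! ### Chambers as skewed binary partitions -/

section Fibres

variable {n : ℕ} {f : Fin n → ℝ} {x : ℝ}

lemma card_levelBlock_comp_perm (f : Fin n → ℝ) (τ : Equiv.Perm (Fin n)) (x : ℝ) :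
    (levelBlock (f ∘ τ) x).card = (levelBlock f x).card :=
  Finset.card_equiv τ fun i => by simp

lemma card_levelBlock_cons (a : ℝ) (f : Fin n → ℝ) (x : ℝ) :
    (levelBlock (Fin.cons a f : Fin (n + 1) → ℝ) x).card =
      (if a = x then 1 else 0) + (levelBlock f x).card := by
  simp only [levelBlock, Fin.card_filter_univ_succ', Fin.cons_zero, Fin.cons_succ]

end Fibres

lemma SkewedBinaryPartition.type_ofLevel {n : ℕ} {f : Fin (n + 1) → ℝ}
    (h : IsSkewedLevel f (· = 0)) : (ofLevel h).type =
      (if f 0 = 0 then [.plain (levelBlock f (-1)).card, .circ ((levelBlock f 0).card - 1)]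
        else [.plain ((levelBlock f (-1)).card - 1), .plain 0]) ++
      (positiveMultiplicities f).map .plain := by
  have hhomog : ∀ i : Fin (dataVector f).length, ¬ (ofLevel h).homog i.succ.succ = true :=
    fun i hi => (dataVector_get_pos i).ne' ((homog_ofLevel_iff h).1 hi).1
  have hzero : 0 ∈ (ofLevel h).block 1 ↔ f 0 = 0 := mem_block_ofLevel h
  unfold type
  rw [if_congr hzero rfl rfl]
  congr 1
  rw [positiveMultiplicities, List.map_map]
  conv_rhs => rw [← List.ofFn_get (dataVector f), List.map_ofFn]
  exact congrArg List.ofFn (funext fun i => if_neg (hhomog i))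

section Chamber

variable {n : ℕ} {u : Fin n → ℝ} {K : ℕ} {τ : Equiv.Perm (Fin n)}

lemma eq_zero_of_chamberLevel_eq_zero (hu : Monotone u) (hu0 : ∀ i, 0 ≤ u i)
    (hK : zeroCount u ≤ K) {p : Fin (n + 1)} (hp : chamberLevel u K τ p = 0) : p = 0 := by
  cases p using Fin.cases with
  | zero => rfl
  | succ p =>
    simp only [chamberLevel, Fin.cons_succ] at hp
    split_ifs at hp with h
    · exact absurd hp ((zeroCount_le_iff hu hu0).1 (hK.trans h)).ne'
    · norm_num at hp

lemma isSkewedLevel_chamberLevel (hu : Monotone u) (hu0 : ∀ i, 0 ≤ u i) (hK : zeroCount u ≤ K)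
    (hKn : K ≤ n) (τ : Equiv.Perm (Fin n)) : IsSkewedLevel (chamberLevel u K τ) (· = 0) where
  range p := by
    cases p using Fin.cases with
    | zero => simp only [chamberLevel, Fin.cons_zero]; split_ifs <;> simp
    | succ p => simp only [chamberLevel, Fin.cons_succ]; split_ifs <;> simp [hu0]
  zero := by simp only [chamberLevel, Fin.cons_zero]; split_ifs <;> simp
  exists_ne_zero h := by
    have hKpos : 0 < K := by
      by_contra hK0
      simp [chamberLevel, hK0] at h
    exact ⟨(τ.symm ⟨0, hKpos.trans_le hKn⟩).succ, Fin.succ_ne_zero _, by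
      simp [chamberLevel, hKpos.ne']⟩
  ne_zero h p hp := by
    rw [eq_zero_of_chamberLevel_eq_zero hu hu0 hK hp, h] at hp
    norm_num at hp
  not_homog := by norm_num
  homog := rfl

/-- The skewed binary partition with preorder `levelOrder (chamberLevel u K τ)`. -/
noncomputable def chamberPartition (hu : Monotone u) (hu0 : ∀ i, 0 ≤ u i) (hK : zeroCount u ≤ K)
    (hKn : K ≤ n) (τ : Equiv.Perm (Fin n)) : SkewedBinaryPartition n :=
  .ofLevel (isSkewedLevel_chamberLevel hu hu0 hK hKn τ)

lemma rel_chamberPartition (hu : Monotone u) (hu0 : ∀ i, 0 ≤ u i) (hK : zeroCount u ≤ K)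
    (hKn : K ≤ n) (τ : Equiv.Perm (Fin n)) :
    (chamberPartition hu hu0 hK hKn τ).rel = levelOrder (chamberLevel u K τ) := by
  ext p q
  rw [chamberPartition, SkewedBinaryPartition.rel_ofLevel_iff, levelOrder]
  refine or_congr_right' fun hne => or_iff_left fun ⟨heq, hp⟩ => hne ?_
  rw [eq_zero_of_chamberLevel_eq_zero hu hu0 hK hp,
    eq_zero_of_chamberLevel_eq_zero hu hu0 hK (heq.symm.trans hp)]

lemma card_levelBlock_chamberLevel (u : Fin n → ℝ) (K : ℕ) (τ : Equiv.Perm (Fin n)) (x : ℝ) :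
    (levelBlock (chamberLevel u K τ) x).card =
      (if (if K = zeroCount u ∧ 0 < K then -1 else 0) = x then 1 else 0) +
        (levelBlock (fun i : Fin n => if K ≤ (i : ℕ) then u i else -1) x).card := by
  rw [← card_levelBlock_comp_perm _ τ, ← card_levelBlock_cons]
  rfl

lemma positiveMultiplicities_chamberLevel (u : Fin n → ℝ) (K : ℕ) (τ : Equiv.Perm (Fin n)) :
    positiveMultiplicities (chamberLevel u K τ) = positiveMultiplicities (truncate u K) := by
  refine positiveMultiplicities_congr fun x hx => ?_
  rw [card_levelBlock_chamberLevel, if_neg (by split_ifs <;> linarith), zero_add]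
  congr 1
  ext i
  rw [mem_levelBlock, mem_levelBlock, truncate]
  split_ifs
  · rfl
  · exact iff_of_false (by linarith) hx.ne

lemma type_chamberPartition (hu : Monotone u) (hu0 : ∀ i, 0 ≤ u i) (hK : zeroCount u ≤ K)
    (hKn : K ≤ n) (τ : Equiv.Perm (Fin n)) :
    (chamberPartition hu hu0 hK hKn τ).type =
      omegaHead (zeroCount u) K ++ (positiveMultiplicities (truncate u K)).map .plain := by
  have hneg : (levelBlock (fun i : Fin n => if K ≤ (i : ℕ) then u i else -1) (-1)).card = K := by
    refine (congrArg _ (Finset.filter_congr fun i _ => ?_)).trans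
      ((Fin.card_filter_val_lt (m := K)).trans (min_eq_right hKn))
    beta_reduce
    split_ifs with h
    · exact iff_of_false (by linarith [hu0 i]) h.not_gt
    · exact iff_of_true rfl (not_le.1 h)
  have hzero : (levelBlock (chamberLevel u K τ) 0).card ≤ 1 :=
    Finset.card_le_one_iff_subset_singleton.2 ⟨0, fun p hp => Finset.mem_singleton.2
      (eq_zero_of_chamberLevel_eq_zero hu hu0 hK (mem_levelBlock.1 hp))⟩
  rw [chamberPartition, SkewedBinaryPartition.type_ofLevel, positiveMultiplicities_chamberLevel,
    omegaHead, card_levelBlock_chamberLevel u K τ (-1), hneg, Nat.sub_eq_zero_of_le hzero]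
  congr 1
  have hf0 : chamberLevel u K τ 0 = if K = zeroCount u ∧ 0 < K then -1 else 0 := rfl
  rw [hf0]
  split_ifs <;> simp_all

lemma chamberLevel_comp_decomposeFin (u : Fin n → ℝ) (K : ℕ) (τ : Equiv.Perm (Fin n)) :
    chamberLevel u K 1 ∘ Equiv.Perm.decomposeFin.symm (0, τ) = chamberLevel u K τ := by
  ext p
  cases p using Fin.cases with
  | zero => rfl
  | succ p =>
    rw [Function.comp_apply, Equiv.Perm.decomposeFin_symm_apply_succ, Equiv.swap_self]
    rfl

theorem mem_chamberOrders_iff (hu : Monotone u) (hu0 : ∀ i, 0 ≤ u i) (hne : u ≠ 0)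
    {r : Fin (n + 1) → Fin (n + 1) → Prop} : r ∈ chamberOrders u ↔
      ∃ A : SkewedBinaryPartition n, A.type ∈ Omega (multiplicityVector u) ∧ A.rel = r := by
  simp only [mem_Omega_multiplicityVector_iff hu hu0 hne]
  constructor
  · rintro ⟨K, τ, hK, hKn, rfl⟩
    exact ⟨chamberPartition hu hu0 hK hKn τ, ⟨K, hK, hKn, type_chamberPartition hu hu0 hK hKn τ⟩,
      rel_chamberPartition hu hu0 hK hKn τ⟩
  · rintro ⟨A, ⟨K, hK, hKn, hA⟩, rfl⟩
    obtain ⟨τ, hτ⟩ := SkewedBinaryPartition.exists_perm_of_type_eq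
      (hA.trans (type_chamberPartition hu hu0 hK hKn 1).symm)
    refine ⟨K, τ, hK, hKn, ?_⟩
    ext p q
    rw [hτ, rel_chamberPartition, ← chamberLevel_comp_decomposeFin u K τ]
    simp [levelOrder]

end Chamber

section NormalFan

variable {n : ℕ} {u : Fin n → ℝ}

lemma mem_normalFan_PF_iff (hu : Monotone u) (hu0 : ∀ i, 0 ≤ u i) (hne : u ≠ 0)
    {σ : Set (Fin n → ℝ)} : σ ∈ normalFan (PF u) ↔
      ∃ B : SBP n (multiplicityVector u), slicedCone B.1.rel = σ := by
  rw [(isVertexFamily_PF hu hu0).mem_normalFan_iff]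
  constructor
  · rintro ⟨s, ⟨r, hr, hsr⟩, rfl⟩
    obtain ⟨A, hA, rfl⟩ := (mem_chamberOrders_iff hu hu0 hne).1 hr
    obtain ⟨B, rfl⟩ := (A.isSkewedBinary_rel.isContraction hsr).exists_rel_eq
    exact ⟨⟨B, A, hA, hsr⟩, rfl⟩
  · rintro ⟨⟨B, A, hA, hBA⟩, rfl⟩
    exact ⟨B.rel, ⟨A.rel, (mem_chamberOrders_iff hu hu0 hne).2 ⟨A, hA, rfl⟩, hBA⟩, rfl⟩

lemma slicedCone_subset_iff_le (hu : Monotone u) (hu0 : ∀ i, 0 ≤ u i) (hne : u ≠ 0)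
    {B B' : SBP n (multiplicityVector u)} :
    slicedCone B.1.rel ⊆ slicedCone B'.1.rel ↔ B ≤ B' := by
  obtain ⟨A, hA, hBA⟩ := B.2
  obtain ⟨A', hA', hBA'⟩ := B'.2
  exact (isVertexFamily_PF hu hu0).slicedCone_subset_iff
    ((mem_chamberOrders_iff hu hu0 hne).2 ⟨A, hA, rfl⟩) hBA
    ((mem_chamberOrders_iff hu hu0 hne).2 ⟨A', hA', rfl⟩) hBA'

lemma slicedCone_rel_injective :
    Function.Injective fun B : SkewedBinaryPartition n => slicedCone B.rel := fun B B' h => by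
  have := B.isPreorder_rel
  have := B'.isPreorder_rel
  exact SkewedBinaryPartition.rel_injective (slicedCone_inj.1 h)

/-- The isomorphism `𝓑 ↦ σ̃_𝓑` from `SBP(m)` onto the normal fan of `PF(m, d)`. -/
noncomputable def slicedConeOrderIso (hu : Monotone u) (hu0 : ∀ i, 0 ≤ u i) (hne : u ≠ 0) :
    SBP n (multiplicityVector u) ≃o normalFan (PF u) where
  toEquiv := Equiv.ofBijective
    (fun B => ⟨slicedCone B.1.rel, (mem_normalFan_PF_iff hu hu0 hne).2 ⟨B, rfl⟩⟩)
    ⟨fun _ _ h => Subtype.ext (slicedCone_rel_injective (congrArg Subtype.val h)), fun σ =>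
      ((mem_normalFan_PF_iff hu hu0 hne).1 σ.2).imp fun _ h => Subtype.ext h⟩
  map_rel_iff' := slicedCone_subset_iff_le hu hu0 hne

/-- The isomorphism from the face poset of `PF(m, d)` onto the dual of `SBP(m)`. -/
noncomputable def facesOrderIsoSBP (hu : Monotone u) (hu0 : ∀ i, 0 ≤ u i) (hne : u ≠ 0) :
    faces (PF u) ≃o (SBP n (multiplicityVector u))ᵒᵈ :=
  (facesOrderIso (PF u)).trans (slicedConeOrderIso hu hu0 hne).symm.dual

end NormalFan

end ParkingPolytope

theorem mainTheorem4 {n : ℕ} (m : List ℕ) (d : List ℝ) (u : Fin n → ℝ)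
    (hu : ParkingPolytope.IsMDPairOf m d u) :
    (∃ e : ParkingPolytope.SBP n m ≃o ParkingPolytope.normalFan (ParkingPolytope.PF u),
      ∀ B : ParkingPolytope.SBP n m,
        (e B : Set (Fin n → ℝ)) = ParkingPolytope.slicedCone B.1.rel) ∧
    Nonempty (ParkingPolytope.faces (ParkingPolytope.PF u) ≃o (ParkingPolytope.SBP n m)ᵒᵈ) ∧
    (∀ (n' : ℕ) (d' : List ℝ) (u' : Fin n' → ℝ), ParkingPolytope.IsMDPairOf m d' u' →
      Nonempty (ParkingPolytope.faces (ParkingPolytope.PF u) ≃o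
        ParkingPolytope.faces (ParkingPolytope.PF u'))) := by
  obtain ⟨hu0, hmono, hne, rfl, -⟩ := hu
  refine ⟨⟨ParkingPolytope.slicedConeOrderIso hmono hu0 hne, fun _ => rfl⟩,
    ⟨ParkingPolytope.facesOrderIsoSBP hmono hu0 hne⟩, ?_⟩
  rintro n' d' u' ⟨hu0', hmono', hne', hmult, -⟩
  obtain rfl : n = n' := by
    rw [← ParkingPolytope.sum_multiplicityVector hu0,
      ← ParkingPolytope.sum_multiplicityVector hu0', hmult]
  have e' := ParkingPolytope.facesOrderIsoSBP hmono' hu0' hne'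
  rw [hmult] at e'
  exact ⟨(ParkingPolytope.facesOrderIsoSBP hmono hu0 hne).trans e'.symm⟩
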